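/- For $n\ge 0$ let $\Pi_n$ be the lattice of set partitions of $\{1,\dots,n\}$ ordered by refinement ($\pi\le\sigma$ if every block of $\sigma$ is a union of blocks of $\pi$), and let $\operatorname{rank}(\pi)$ be the maximal length of a chain in $\Pi_n$ with top element $\pi$. For a finite set $T$ of positive integers let $\alpha_T(\Pi_n)$ be the character of the permutation representation of the symmetric group $S_n$ on the maximal chains of the subposet $\{\pi\in\Pi_n:\operatorname{rank}(\pi)\in T\}$, and let $$\beta_S(\Pi_n)=\sum_{T\subseteq S}(-1)^{|S\setminus T|}\,\alpha_T(\Pi_n)$$ be the (virtual) character of the rank-selected homology of $\Pi_n$. For an integer partition $\lambda=(\lambda_1\ge\dots\ge\lambda_\ell)$ let $\chi^\lambda$ be the irreducible character of $S_{|\lambda|}$ indexed by $\lambda$, i.e. the one whose Frobenius characteristic is the Schur function $s_\lambda$. A sequence $(\chi_n)_{n\ge0}$ of virtual $S_n$-characters is said to stabilize beyond $n_0$ if, writing $\chi_{n_0}=\sum_{|\lambda|=n_0}c_\lambda\chi^\lambda$ with $c_\lambda\in\mathbb Z$, one has $$\chi_n=\sum_{|\lambda|=n_0}c_\lambda\,\chi^{(\lambda_1+n-n_0,\lambda_2,\dots,\lambda_\ell)}\qquad\text{for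 all } n\ge n_0;$$ it stabilizes sharply at $n_0$ if $n_0$ is the smallest nonnegative integer with this property. **Theorem.** Let $S$ be a finite nonempty set of positive integers and $i=\max(S)$. Then the sequence $\beta_S(\Pi_n)$ stabilizes beyond $n=4i$. Furthermore, when $S=\{i\}$, it stabilizes sharply at $n=4i$. -/

import Mathlib

namespace RankSelection

/-! ### Rank selection in a poset with an automorphism

`Order.height p` is the supremum of the lengths of the chains with top element `p`; in a finite
graded poset with minimum element it is the rank of `p`. -/

/-- The rank-selected subposet `P^S = {p ∈ P : rank p ∈ S}`. -/
def rankSelected (P : Type*) [PartialOrder P] (S : Finset ℕ) : Set P :=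
  {p | ∃ s ∈ S, Order.height p = (s : ℕ∞)}

/-- The maximal chains (totally ordered subsets, maximal under inclusion) of `P^S`. -/
def maxChains (P : Type*) [PartialOrder P] (S : Finset ℕ) : Set (Set P) :=
  {C | Maximal (fun D : Set P => D ⊆ rankSelected P S ∧ IsChain (· ≤ ·) D) C}

/-- The value at an automorphism `e` of the permutation character `α_S(P)`: the number of
maximal chains of `P^S` that are mapped to themselves by `e`. -/
noncomputable def alphaChar {P : Type*} [PartialOrder P] (S : Finset ℕ) (e : P ≃o P) : ℤ :=
  ({C ∈ maxChains P S | e '' C = C}.ncard : ℤ)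

/-- The value at an automorphism `e` of the virtual character
`β_S(P) = ∑_{T ⊆ S} (-1)^{|S - T|} α_T(P)`. -/
noncomputable def betaChar {P : Type*} [PartialOrder P] (S : Finset ℕ) (e : P ≃o P) : ℤ :=
  ∑ T ∈ S.powerset, (-1) ^ (S \ T).card * alphaChar T e

/-! ### The lattice of set partitions

Set partitions of an `n`-element set are the equivalence relations on `Fin n`, the blocks being
the classes. In the order on `Setoid (Fin n)`, `r ≤ s` means that `r a b` implies `s a b`, that
is, every block of `s` is a union of blocks of `r`. -/

/-- The action of a permutation `w` on set partitions: it maps each block `B` to `w B`. -/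
def permute {n : ℕ} (w : Equiv.Perm (Fin n)) : Setoid (Fin n) ≃o Setoid (Fin n) where
  toFun r := Setoid.comap (w⁻¹ : Equiv.Perm (Fin n)) r
  invFun r := Setoid.comap w r
  left_inv r := by
    ext a b
    simp [Setoid.comap_rel]
  right_inv r := by
    ext a b
    simp [Setoid.comap_rel]
  map_rel_iff' := by
    intro r s
    constructor
    · intro h a b hab
      have key : r (w⁻¹ (w a)) (w⁻¹ (w b)) → s (w⁻¹ (w a)) (w⁻¹ (w b)) := @h (w a) (w b)
      simp only [← Equiv.Perm.mul_apply, inv_mul_cancel, Equiv.Perm.one_apply] at key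
      exact key hab
    · intro h a b hab
      exact h hab

/-- The character `β_S(Π_n)` of the symmetric group `S_n`. -/
noncomputable def betaPartition (S : Finset ℕ) (n : ℕ) (w : Equiv.Perm (Fin n)) : ℤ :=
  betaChar S (permute w)

/-! ### Irreducible characters of the symmetric groups -/

/-- For integers `α_0, …, α_{ℓ-1}` with sum `n`: the value at `w` of the character of `S_n` with
Frobenius characteristic `h_{α_0} ⋯ h_{α_{ℓ-1}}` (where `h_d = 0` for `d < 0`). If all `α_j ≥ 0`
this is the trivial character of the Young subgroup of type `α` induced to `S_n`, that is, the
permutation character on ordered set partitions of `Fin n` with block sizes `α_0, …, α_{ℓ-1}`,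
which are encoded as maps `f` with fibers of these sizes; `w` fixes `f` iff `f ∘ w = f`. -/
def youngChar {l n : ℕ} (α : Fin l → ℤ) (w : Equiv.Perm (Fin n)) : ℤ :=
  ((Finset.univ.filter fun f : Fin n → Fin l =>
    (∀ x, f (w x) = f x) ∧
      ∀ j, ((Finset.univ.filter fun x => f x = j).card : ℤ) = α j).card : ℤ)

/-- For a partition `L = (λ_1 ≥ … ≥ λ_ℓ)` of `n`, the value at `w` of the irreducible character
`χ^λ` of `S_n`, the class function with Frobenius characteristic the Schur function
`s_λ = det (h_{λ_i - i + j})_{i,j}`, written out as an alternating sum over the permutations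
of the columns. -/
def irrChar (L : List ℕ) {n : ℕ} (w : Equiv.Perm (Fin n)) : ℤ :=
  ∑ σ : Equiv.Perm (Fin L.length),
    (Equiv.Perm.sign σ : ℤ) *
      youngChar (fun i => (L.get i : ℤ) - (i : ℕ) + (σ i : ℕ)) w

/-- The parts of an integer partition as a weakly decreasing list `(λ_1 ≥ λ_2 ≥ … ≥ λ_ℓ)`. -/
def rows {n : ℕ} (p : n.Partition) : List ℕ := p.parts.sort (· ≥ ·)

/-- `λ + (m) = (λ_1 + m, λ_2, …, λ_ℓ)`; for the empty partition `λ_1 = 0`. -/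
def addFirstRow (m : ℕ) : List ℕ → List ℕ
  | [] => [m]
  | a :: L => (a + m) :: L

/-! ### Representation stability -/

/-- A sequence `χ_n` of (virtual) `S_n`-characters stabilizes beyond `n₀`: if
`χ_{n₀} = ∑_λ c_λ χ^λ`, then `χ_{n₀ + m} = ∑_λ c_λ χ^{λ + (m)}` for all `m ≥ 0`.
(The multiplicities `c_λ` exist and are unique because the `χ^λ` are a `ℤ`-basis of the virtual
characters.) -/
def StabilizesBeyond (χ : ∀ n : ℕ, Equiv.Perm (Fin n) → ℤ) (n₀ : ℕ) : Prop :=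
  ∃ c : n₀.Partition → ℤ,
    (∀ w : Equiv.Perm (Fin n₀), χ n₀ w = ∑ p, c p * irrChar (rows p) w) ∧
    ∀ (m : ℕ) (w : Equiv.Perm (Fin (n₀ + m))),
      χ (n₀ + m) w = ∑ p, c p * irrChar (addFirstRow m (rows p)) w

/-- The sequence stabilizes sharply at `n₀`: `n₀` is minimal such that it stabilizes beyond
`n₀`. -/
def StabilizesSharplyAt (χ : ∀ n : ℕ, Equiv.Perm (Fin n) → ℤ) (n₀ : ℕ) : Prop :=
  IsLeast {k | StabilizesBeyond χ k} n₀

end RankSelection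

namespace RankSelection

open Finset

section CompleteHomogeneous

variable {R : Type*} [CommRing R] {l : ℕ}

/-- The complete homogeneous symmetric polynomial of degree `a` in the elements `x_j`,
as a coefficient of `∏ 1 / (1 - x_j T)`. -/
noncomputable def completeHom (x : Fin l → R) (a : ℤ) : R :=
  if 0 ≤ a then PowerSeries.coeff a.toNat (∏ j, PowerSeries.mk fun n => x j ^ n) else 0

theorem completeHom_natCast (x : Fin l → R) (a : ℕ) :
    completeHom x a = PowerSeries.coeff a (∏ j, PowerSeries.mk fun n => x j ^ n) := by
  simp [completeHom]

theorem completeHom_of_neg (x : Fin l → R) {a : ℤ} (ha : a < 0) : completeHom x a = 0 := by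
  simp [completeHom, not_le.mpr ha]

theorem completeHom_zero (x : Fin l → R) : completeHom x 0 = 1 := by
  have := completeHom_natCast x 0
  rw [Nat.cast_zero] at this
  rw [this, PowerSeries.coeff_zero_eq_constantCoeff_apply, map_prod]
  refine Finset.prod_eq_one fun j _ => ?_
  rw [← PowerSeries.coeff_zero_eq_constantCoeff_apply, PowerSeries.coeff_mk, pow_zero]

/-- The product of the factors `1 - x_j T` over `j ≠ k`. -/
noncomputable def elemSeries (x : Fin l → R) (k : Fin l) : PowerSeries R :=
  ∏ j ∈ univ.erase k, (1 - PowerSeries.C (x j) * PowerSeries.X)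

theorem coeff_prod_one_sub_eq_zero {ι : Type*} [DecidableEq ι] (x : ι → R) (s : Finset ι) (b : ℕ)
    (hb : s.card < b) :
    PowerSeries.coeff b (∏ j ∈ s, (1 - PowerSeries.C (x j) * PowerSeries.X)) = 0 := by
  induction s using Finset.induction_on generalizing b with
  | empty =>
    rw [Finset.prod_empty, PowerSeries.coeff_one, if_neg]
    rw [Finset.card_empty] at hb; omega
  | insert i s hi ih =>
    rw [Finset.card_insert_of_notMem hi] at hb
    obtain ⟨b, rfl⟩ : ∃ c, b = c + 1 := ⟨b - 1, by omega⟩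
    rw [Finset.prod_insert hi, sub_mul, one_mul, map_sub, ih _ (by omega), mul_assoc,
      PowerSeries.coeff_C_mul, PowerSeries.coeff_succ_X_mul, ih _ (by omega)]
    simp

theorem coeff_elemSeries_eq_zero (x : Fin l → R) (k : Fin l) {b : ℕ} (hb : l ≤ b) :
    PowerSeries.coeff b (elemSeries x k) = 0 := by
  apply coeff_prod_one_sub_eq_zero
  have := k.isLt
  rw [Finset.card_erase_of_mem (mem_univ k), Finset.card_univ, Fintype.card_fin]
  omega

theorem prod_geom_mul_elemSeries (x : Fin l → R) (k : Fin l) :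
    (∏ j, PowerSeries.mk fun n => x j ^ n) * elemSeries x k = PowerSeries.mk fun n => x k ^ n := by
  have h : ∀ y : R, (PowerSeries.mk fun n => y ^ n) * (1 - PowerSeries.C y * PowerSeries.X) = 1 := by
    intro y
    ext n
    rw [mul_sub, mul_one, map_sub, mul_comm (PowerSeries.C y), ← mul_assoc]
    rcases n with _ | n
    · simp
    · rw [PowerSeries.coeff_mul_C, PowerSeries.coeff_succ_mul_X, PowerSeries.coeff_mk,
        PowerSeries.coeff_mk, PowerSeries.coeff_one, pow_succ]
      simp
  rw [elemSeries, ← Finset.mul_prod_erase univ _ (mem_univ k), mul_assoc,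
    ← Finset.prod_mul_distrib, Finset.prod_congr rfl fun j _ => h (x j), Finset.prod_const_one,
    mul_one]

theorem sum_completeHom_mul_elemSeries (x : Fin l → R) (k : Fin l) (N : ℕ) :
    ∑ j : Fin l, completeHom x ((N : ℤ) - (l - 1 : ℤ) + (j : ℕ)) *
      PowerSeries.coeff (l - 1 - (j : ℕ)) (elemSeries x k) = x k ^ N := by
  set F : ℕ → R := fun m =>
    completeHom x ((N : ℤ) - m) * PowerSeries.coeff m (elemSeries x k) with hF
  have h1 : ∑ j : Fin l, completeHom x ((N : ℤ) - (l - 1 : ℤ) + (j : ℕ)) *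
      PowerSeries.coeff (l - 1 - (j : ℕ)) (elemSeries x k) = ∑ m ∈ range l, F m := by
    rw [Finset.sum_range, ← Equiv.sum_comp Fin.revPerm]
    refine Finset.sum_congr rfl fun j _ => ?_
    simp only [hF, Fin.revPerm_apply, Fin.val_rev]
    have := j.isLt
    congr 2
    · push_cast [Nat.cast_sub (show (j : ℕ) + 1 ≤ l by omega)]
      ring
    · congr 1
      omega
  have h2 : x k ^ N = ∑ m ∈ range (N + 1), F m := by
    have := congrArg (PowerSeries.coeff N) (prod_geom_mul_elemSeries x k)
    rw [PowerSeries.coeff_mk, mul_comm, PowerSeries.coeff_mul,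
      Finset.Nat.sum_antidiagonal_eq_sum_range_succ_mk] at this
    rw [← this]
    refine Finset.sum_congr rfl fun m hm => ?_
    rw [Finset.mem_range] at hm
    simp only [hF]
    rw [← Nat.cast_sub (by omega), completeHom_natCast, mul_comm]
  rw [h1, h2]
  have e1 : ∑ m ∈ range l, F m = ∑ m ∈ range (l + (N + 1)), F m := by
    refine Finset.sum_subset (Finset.range_mono (by omega)) fun m _ hm => ?_
    rw [Finset.mem_range, not_lt] at hm
    simp only [hF]
    rw [coeff_elemSeries_eq_zero x k hm, mul_zero]
  have e2 : ∑ m ∈ range (N + 1), F m = ∑ m ∈ range (l + (N + 1)), F m := by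
    refine Finset.sum_subset (Finset.range_mono (by omega)) fun m _ hm => ?_
    rw [Finset.mem_range, not_lt] at hm
    simp only [hF]
    rw [completeHom_of_neg x (by omega), zero_mul]
  rw [e1, e2]

/-- The Jacobi–Trudi determinant `det (h_{α_i - i + j})`. -/
noncomputable def jacobiTrudi {q : ℕ} (x : Fin l → R) (α : Fin q → ℤ) : R :=
  Matrix.det (Matrix.of fun i j : Fin q => completeHom x (α i - (i : ℕ) + (j : ℕ)))

/-- A Jacobi–Trudi determinant whose rows after the first are zero is a single `h_a`. -/
theorem jacobiTrudi_of_tail_zero {q : ℕ} (x : Fin l → R) (α : Fin (q + 1) → ℤ)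
    (hα : ∀ i, i ≠ 0 → α i = 0) : jacobiTrudi x α = completeHom x (α 0) := by
  rw [jacobiTrudi, Matrix.det_of_isUpperTriangular, Fin.prod_univ_succ]
  · rw [Finset.prod_eq_one]
    · simp
    · intro i _
      simp [hα _ (Fin.succ_ne_zero i), completeHom_zero]
  · intro i j hij
    have hij' : (j : ℕ) < i := hij
    have hi : i ≠ 0 := by
      rintro rfl
      simp at hij'
    simp only [Matrix.of_apply, hα i hi]
    exact completeHom_of_neg x (by omega)

theorem jacobiTrudi_zero {q : ℕ} (x : Fin l → R) :
    jacobiTrudi x (fun _ : Fin q => (0 : ℤ)) = 1 := by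
  rcases q with _ | q
  · simp [jacobiTrudi]
  · rw [jacobiTrudi_of_tail_zero x _ fun _ _ => rfl, completeHom_zero]

/-- The equality of the Jacobi–Trudi and the bialternant formula. -/
theorem jacobiTrudi_mul_alternant (x : Fin l → R) (N : Fin l → ℕ) :
    jacobiTrudi x (fun i => (N i : ℤ) - (l - 1 : ℤ) + (i : ℕ)) *
      Matrix.det (Matrix.of fun i k : Fin l => x k ^ (l - 1 - (i : ℕ))) =
    Matrix.det (Matrix.of fun i k : Fin l => x k ^ N i) := by
  set B : Matrix (Fin l) (Fin l) R :=
    Matrix.of fun j k => PowerSeries.coeff (l - 1 - (j : ℕ)) (elemSeries x k) with hB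
  have key : ∀ N : Fin l → ℕ,
      jacobiTrudi x (fun i => (N i : ℤ) - (l - 1 : ℤ) + (i : ℕ)) * B.det =
      Matrix.det (Matrix.of fun i k : Fin l => x k ^ N i) := by
    intro N
    rw [jacobiTrudi, ← Matrix.det_mul]
    congr 1
    ext i k
    rw [Matrix.mul_apply, Matrix.of_apply, ← sum_completeHom_mul_elemSeries x k (N i)]
    refine Finset.sum_congr rfl fun j _ => ?_
    simp only [hB, Matrix.of_apply]
    congr 2
    ring
  have h0 := key fun i => l - 1 - (i : ℕ)
  have h1 : (fun i : Fin l => ((l - 1 - (i : ℕ) : ℕ) : ℤ) - (l - 1 : ℤ) + (i : ℕ)) =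
      fun _ => (0 : ℤ) := by
    funext i
    have := i.isLt
    omega
  rw [h1, jacobiTrudi_zero, one_mul] at h0
  rw [← h0, key]

/-- Appending zero rows does not change a Jacobi–Trudi determinant. -/
theorem jacobiTrudi_append_zero {q p : ℕ} (hqp : q ≤ p) (x : Fin l → R) (α : Fin p → ℤ)
    (hα : ∀ i : Fin p, q ≤ (i : ℕ) → α i = 0) :
    jacobiTrudi x α = jacobiTrudi x (fun i : Fin q => α (Fin.castLE hqp i)) := by
  induction p, hqp using Nat.le_induction with
  | base => rfl
  | succ p hqp ih =>
    have h1 : jacobiTrudi x α = jacobiTrudi x (fun i : Fin p => α i.castSucc) := by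
      rw [jacobiTrudi, Matrix.det_succ_row _ (Fin.last p), Fin.sum_univ_castSucc,
        Finset.sum_eq_zero, zero_add, jacobiTrudi]
      · have h2 : α (Fin.last p) = 0 := hα _ (by simpa using hqp)
        simp only [Fin.val_last, Matrix.of_apply, h2, zero_sub, neg_add_cancel, completeHom_zero,
          Fin.succAbove_last, ← two_mul]
        rw [pow_mul]
        simp only [even_two, Even.neg_pow, one_pow, mul_one, one_mul]
        congr 1
      · intro j _
        have h2 : α (Fin.last p) = 0 := hα _ (by simpa using hqp)
        have := j.isLt
        rw [Matrix.of_apply, h2, completeHom_of_neg x (by simp), mul_zero, zero_mul]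
    rw [h1, ih _ fun i hi => hα _ (by simpa using hi)]
    rfl

end CompleteHomogeneous

section AlternantCoefficient

open MvPolynomial

variable {l : ℕ}

/-- The coefficient of a polynomial at an integer exponent vector; it is zero if the vector has a
negative entry. -/
noncomputable def coeffZ (P : MvPolynomial (Fin l) ℤ) (α : Fin l → ℤ) : ℤ :=
  if ∀ j, 0 ≤ α j then P.coeff (Finsupp.equivFunOnFinite.symm fun j => (α j).toNat) else 0

theorem coeffZ_smul (c : ℤ) (P : MvPolynomial (Fin l) ℤ) (α : Fin l → ℤ) :
    coeffZ (c • P) α = c * coeffZ P α := by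
  unfold coeffZ
  split_ifs
  · rw [coeff_smul, smul_eq_mul]
  · rw [mul_zero]

theorem coeffZ_sum {ι : Type*} (s : Finset ι) (P : ι → MvPolynomial (Fin l) ℤ) (α : Fin l → ℤ) :
    coeffZ (∑ i ∈ s, P i) α = ∑ i ∈ s, coeffZ (P i) α := by
  unfold coeffZ
  split_ifs <;> simp [coeff_sum]

/-- The coefficient of `x^{Λ + δ}` in the product of `P` and the alternant `a_δ`. -/
noncomputable def altCoeff (Λ : Fin l → ℤ) (P : MvPolynomial (Fin l) ℤ) : ℤ :=
  ∑ σ : Equiv.Perm (Fin l), (Equiv.Perm.sign σ : ℤ) *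
    coeffZ P (fun k => Λ k - (k : ℕ) + (σ k : ℕ))

theorem altCoeff_smul (Λ : Fin l → ℤ) (c : ℤ) (P : MvPolynomial (Fin l) ℤ) :
    altCoeff Λ (c • P) = c * altCoeff Λ P := by
  simp only [altCoeff, coeffZ_smul, Finset.mul_sum]
  exact Finset.sum_congr rfl fun _ _ => by ring

theorem altCoeff_sum {ι : Type*} (Λ : Fin l → ℤ) (s : Finset ι)
    (P : ι → MvPolynomial (Fin l) ℤ) :
    altCoeff Λ (∑ i ∈ s, P i) = ∑ i ∈ s, altCoeff Λ (P i) := by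
  simp only [altCoeff, coeffZ_sum, Finset.mul_sum]
  exact Finset.sum_comm

theorem det_pow_eq_sum_monomial (N : Fin l → ℕ) :
    Matrix.det (Matrix.of fun i k : Fin l => (X k : MvPolynomial (Fin l) ℤ) ^ N i) =
    ∑ σ : Equiv.Perm (Fin l), (Equiv.Perm.sign σ : ℤ) •
      monomial (Finsupp.equivFunOnFinite.symm fun k => N (σ k)) (1 : ℤ) := by
  rw [Matrix.det_apply]
  refine Finset.sum_congr rfl fun σ _ => ?_
  rw [Units.smul_def]
  congr 1
  rw [monomial_eq, Finsupp.prod_fintype _ _ (fun i => pow_zero _)]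
  simp

theorem altCoeff_eq_coeff_mul (Λ : Fin l → ℤ) (N : Fin l → ℕ)
    (hN : ∀ k, (N k : ℤ) = Λ k + (l - 1 : ℤ) - (k : ℕ)) (P : MvPolynomial (Fin l) ℤ) :
    altCoeff Λ P = coeff (Finsupp.equivFunOnFinite.symm N)
      (Matrix.det (Matrix.of fun i k : Fin l => (X k : MvPolynomial (Fin l) ℤ) ^ (l - 1 - (i : ℕ)))
        * P) := by
  rw [det_pow_eq_sum_monomial (fun i : Fin l => l - 1 - (i : ℕ)), Finset.sum_mul, coeff_sum,
    altCoeff]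
  refine Finset.sum_congr rfl fun σ _ => ?_
  rw [smul_mul_assoc, coeff_smul, smul_eq_mul, coeff_monomial_mul', one_mul, coeffZ]
  congr 1
  have hle : (Finsupp.equivFunOnFinite.symm (fun k => l - 1 - (σ k : ℕ)) ≤
      Finsupp.equivFunOnFinite.symm N) ↔ ∀ j : Fin l, 0 ≤ Λ j - (j : ℕ) + (σ j : ℕ) := by
    rw [Finsupp.le_def]
    refine forall_congr' fun k => ?_
    have h1 := hN k
    have h2 := (σ k).isLt
    simp only [Finsupp.equivFunOnFinite_symm_apply_apply]
    omega
  by_cases h : ∀ j : Fin l, 0 ≤ Λ j - (j : ℕ) + (σ j : ℕ)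
  · rw [if_pos h, if_pos (hle.mpr h)]
    congr 1
    ext k
    have h1 := hN k
    have h2 := (σ k).isLt
    have h3 := h k
    simp only [Finsupp.equivFunOnFinite_symm_apply_apply, Finsupp.tsub_apply]
    omega
  · rw [if_neg h, if_neg (mt hle.mp h)]

theorem altCoeff_jacobiTrudi_mul_monomial (Λ α : Fin l → ℤ) (hΛ : ∀ k, 0 ≤ Λ k)
    (hα : ∀ k, 0 ≤ α k) (β : Fin l →₀ ℕ) :
    altCoeff Λ (jacobiTrudi X α * monomial β 1) =
      ∑ σ : Equiv.Perm (Fin l), (Equiv.Perm.sign σ : ℤ) *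
        if ∀ k, Λ k - (k : ℕ) = α (σ k) - (σ k : ℕ) + β k then 1 else 0 := by
  have hN : ∀ γ : Fin l → ℤ, (∀ k, 0 ≤ γ k) → ∀ k : Fin l,
      (((γ k + (l - 1 : ℤ) - (k : ℕ)).toNat : ℕ) : ℤ) = γ k + (l - 1 : ℤ) - (k : ℕ) := by
    intro γ hγ k
    have := k.isLt
    have := hγ k
    omega
  rw [altCoeff_eq_coeff_mul Λ _ (hN Λ hΛ), ← mul_assoc, mul_comm (Matrix.det _)]
  have h := jacobiTrudi_mul_alternant (X : Fin l → MvPolynomial (Fin l) ℤ)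
    (fun k => (α k + (l - 1 : ℤ) - (k : ℕ)).toNat)
  have hα' : (fun i : Fin l => (((α i + (l - 1 : ℤ) - (i : ℕ)).toNat : ℕ) : ℤ) - (l - 1 : ℤ)
      + (i : ℕ)) = α := by
    funext i
    rw [hN α hα]
    ring
  rw [hα'] at h
  rw [h, det_pow_eq_sum_monomial, Finset.sum_mul, coeff_sum]
  refine Finset.sum_congr rfl fun σ _ => ?_
  rw [smul_mul_assoc, coeff_smul, smul_eq_mul, monomial_mul, coeff_monomial, one_mul]
  congr 1
  refine if_congr ?_ rfl rfl
  rw [DFunLike.ext_iff]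
  refine forall_congr' fun k => ?_
  have h1 := hN α hα (σ k)
  have h2 := hN Λ hΛ k
  simp only [Finsupp.add_apply, Finsupp.equivFunOnFinite_symm_apply_apply]
  rw [← Nat.cast_inj (R := ℤ), Nat.cast_add, h1, h2]
  constructor <;> intro h <;> linarith

theorem strictMono_neg_sub_val {Λ : Fin l → ℤ} (hΛ : Antitone Λ) :
    StrictMono fun k : Fin l => -(Λ k - (k : ℕ)) := by
  intro i j hij
  have h1 := hΛ hij.le
  have h2 : (i : ℕ) < j := hij
  simp only
  omega

theorem altCoeff_jacobiTrudi {Λ α : Fin l → ℤ} (hΛ : ∀ k, 0 ≤ Λ k) (hα : ∀ k, 0 ≤ α k)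
    (hΛ' : Antitone Λ) (hα' : Antitone α) :
    altCoeff Λ (jacobiTrudi X α) = if Λ = α then 1 else 0 := by
  have h := altCoeff_jacobiTrudi_mul_monomial Λ α hΛ hα 0
  rw [show (monomial (0 : Fin l →₀ ℕ) (1 : ℤ)) = 1 from rfl, mul_one] at h
  rw [h]
  have key : ∀ σ : Equiv.Perm (Fin l),
      (∀ k, Λ k - (k : ℕ) = α (σ k) - (σ k : ℕ) + (0 : Fin l →₀ ℕ) k) → Λ = α ∧ σ = 1 := by
    intro σ hσ
    have e1 : (fun k : Fin l => -(Λ k - (k : ℕ))) = fun k : Fin l => -(α k - (k : ℕ)) := by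
      refine (StrictMono.range_inj (strictMono_neg_sub_val hΛ') (strictMono_neg_sub_val hα')).mp ?_
      rw [← σ.surjective.range_comp (fun k : Fin l => -(α k - (k : ℕ)))]
      congr 1
      funext k
      simp [hσ k]
    have e2 : Λ = α := by
      funext k
      have := congrFun e1 k
      linarith
    refine ⟨e2, Equiv.ext fun k => ?_⟩
    refine (strictMono_neg_sub_val hα').injective ?_
    have := hσ k
    simp only [Finsupp.coe_zero, Pi.zero_apply, e2] at this
    simp only [Equiv.Perm.one_apply, this]
    simp
  split_ifs with hΛα
  · rw [Finset.sum_eq_single 1]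
    · simp [hΛα]
    · intro σ _ hσ
      rw [if_neg fun h => hσ (key σ h).2, mul_zero]
    · simp
  · refine Finset.sum_eq_zero fun σ _ => ?_
    rw [if_neg fun h => hΛα (key σ h).1, mul_zero]

end AlternantCoefficient

section Stability

open MvPolynomial

variable {q : ℕ}

theorem altCoeff_completeHom_mul_monomial (Λ : Fin (q + 1) → ℤ) (hΛ : ∀ k, 0 ≤ Λ k) (a : ℕ)
    (β : Fin (q + 1) →₀ ℕ) :
    altCoeff Λ (completeHom X a * monomial β 1) =
      ∑ σ : Equiv.Perm (Fin (q + 1)), (Equiv.Perm.sign σ : ℤ) *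
        if ∀ k, Λ k - (k : ℕ) = (if σ k = 0 then (a : ℤ) else 0) - (σ k : ℕ) + β k
          then 1 else 0 := by
  have h := jacobiTrudi_of_tail_zero (X : Fin (q + 1) → MvPolynomial (Fin (q + 1)) ℤ)
    (fun i : Fin (q + 1) => if i = 0 then (a : ℤ) else 0) (fun i hi => if_neg hi)
  rw [if_pos rfl] at h
  rw [← h, altCoeff_jacobiTrudi_mul_monomial Λ _ hΛ]
  intro k
  split_ifs <;> simp

theorem fixes_zero_of_shape {Λ : Fin (q + 1) → ℤ} (hΛ : ∀ k, 0 ≤ Λ k)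
    (hΛ' : Antitone Λ) {a r : ℕ} (hra : r ≤ a) (hsum : ∑ k, Λ k = a + r)
    {β : Fin (q + 1) →₀ ℕ} {σ : Equiv.Perm (Fin (q + 1))}
    (h : ∀ k, Λ k - (k : ℕ) = (if σ k = 0 then (a : ℤ) else 0) - (σ k : ℕ) + β k) :
    σ 0 = 0 ∧ Λ 0 = a + β 0 := by
  have h0 : σ 0 = 0 := by
    by_contra hne
    set k := σ.symm 0 with hk
    have hσk : σ k = 0 := by simp [hk]
    have hk0 : k ≠ 0 := by
      intro hk0
      rw [hk0] at hσk
      exact hne hσk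
    have h1 := h k
    rw [hσk] at h1
    simp only [if_true, Fin.val_zero, Nat.cast_zero] at h1
    have h2 : 1 ≤ (k : ℕ) := Nat.one_le_iff_ne_zero.mpr fun h => hk0 (Fin.ext h)
    have h3 := hΛ' (Fin.zero_le k)
    have h4 : Λ 0 + Λ k ≤ ∑ k, Λ k := by
      rw [← Finset.sum_pair hk0.symm]
      exact Finset.sum_le_sum_of_subset_of_nonneg (subset_univ _) fun i _ _ => hΛ i
    omega
  refine ⟨h0, ?_⟩
  have h1 := h 0
  rw [h0] at h1
  simpa using h1

theorem altCoeff_monomial_eq_zero {Λ : Fin (q + 1) → ℤ} (hΛ : ∀ k, 0 ≤ Λ k)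
    (hΛ' : Antitone Λ) {a r : ℕ} (hra : r ≤ a) (hsum : ∑ k, Λ k = a + r) (hlt : Λ 0 < a)
    (β : Fin (q + 1) →₀ ℕ) :
    altCoeff Λ (completeHom X a * monomial β 1) = 0 := by
  rw [altCoeff_completeHom_mul_monomial Λ hΛ]
  refine Finset.sum_eq_zero fun σ _ => ?_
  rw [if_neg, mul_zero]
  intro h
  have := (fixes_zero_of_shape hΛ hΛ' hra hsum h).2
  omega

theorem altCoeff_monomial_stable {Λ : Fin (q + 1) → ℤ} (hΛ : ∀ k, 0 ≤ Λ k)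
    (hΛ' : Antitone Λ) {a r : ℕ} (hra : r ≤ a) (hsum : ∑ k, Λ k = a + r) (m : ℕ)
    (β : Fin (q + 1) →₀ ℕ) :
    altCoeff (fun k => if k = 0 then Λ k + m else Λ k)
        (completeHom X ((a + m : ℕ) : ℤ) * monomial β 1) =
      altCoeff Λ (completeHom X a * monomial β 1) := by
  have hM : ∀ k : Fin (q + 1), 0 ≤ (if k = 0 then Λ k + m else Λ k) := by
    intro k
    have := hΛ k
    split_ifs <;> omega
  have hM' : Antitone fun k : Fin (q + 1) => if k = 0 then Λ k + m else Λ k := by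
    intro i j hij
    have := hΛ' hij
    by_cases hj : j = 0
    · have hi : i = 0 := by
        rw [hj] at hij
        exact le_antisymm hij (Fin.zero_le _)
      simp [hi, hj]
    · simp only [hj, if_false]
      split_ifs <;> omega
  have hMs : ∑ k : Fin (q + 1), (if k = 0 then Λ k + m else Λ k) = ((a + m : ℕ) : ℤ) + r := by
    rw [Fin.sum_univ_succ] at hsum ⊢
    simp only [if_true, Fin.succ_ne_zero, if_false]
    push_cast
    linarith
  rw [altCoeff_completeHom_mul_monomial _ hM, altCoeff_completeHom_mul_monomial Λ hΛ]
  refine Finset.sum_congr rfl fun σ _ => ?_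
  congr 1
  refine if_congr ⟨fun h => ?_, fun h => ?_⟩ rfl rfl
  · have h0 := (fixes_zero_of_shape hM hM' (by omega) hMs h).1
    intro k
    have hk := h k
    by_cases hk0 : k = 0
    · subst hk0
      simp only [h0, if_true] at hk ⊢
      push_cast at hk
      linarith
    · have : σ k ≠ 0 := fun h => hk0 (σ.injective (h.trans h0.symm))
      simpa only [hk0, this, if_false] using hk
  · have h0 := (fixes_zero_of_shape hΛ hΛ' hra hsum h).1
    intro k
    have hk := h k
    by_cases hk0 : k = 0
    · subst hk0
      simp only [h0, if_true] at hk ⊢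
      push_cast
      linarith
    · have : σ k ≠ 0 := fun h => hk0 (σ.injective (h.trans h0.symm))
      simpa only [hk0, this, if_false] using hk

theorem altCoeff_mul_eq_sum (Λ : Fin q → ℤ) (Q P : MvPolynomial (Fin q) ℤ) :
    altCoeff Λ (Q * P) = ∑ β ∈ P.support, coeff β P * altCoeff Λ (Q * monomial β 1) := by
  conv_lhs => rw [P.as_sum, Finset.mul_sum]
  rw [altCoeff_sum]
  refine Finset.sum_congr rfl fun β _ => ?_
  rw [← altCoeff_smul, ← mul_smul_comm, smul_monomial, smul_eq_mul, mul_one]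

theorem altCoeff_eq_zero {Λ : Fin (q + 1) → ℤ} (hΛ : ∀ k, 0 ≤ Λ k)
    (hΛ' : Antitone Λ) {a r : ℕ} (hra : r ≤ a) (hsum : ∑ k, Λ k = a + r) (hlt : Λ 0 < a)
    (P : MvPolynomial (Fin (q + 1)) ℤ) :
    altCoeff Λ (completeHom X a * P) = 0 := by
  rw [altCoeff_mul_eq_sum]
  refine Finset.sum_eq_zero fun β _ => ?_
  rw [altCoeff_monomial_eq_zero hΛ hΛ' hra hsum hlt, mul_zero]

theorem altCoeff_stable {Λ : Fin (q + 1) → ℤ} (hΛ : ∀ k, 0 ≤ Λ k)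
    (hΛ' : Antitone Λ) {a r : ℕ} (hra : r ≤ a) (hsum : ∑ k, Λ k = a + r) (m : ℕ)
    (P : MvPolynomial (Fin (q + 1)) ℤ) :
    altCoeff (fun k => if k = 0 then Λ k + m else Λ k)
        (completeHom X ((a + m : ℕ) : ℤ) * P) =
      altCoeff Λ (completeHom X a * P) := by
  rw [altCoeff_mul_eq_sum, altCoeff_mul_eq_sum]
  refine Finset.sum_congr rfl fun β _ => ?_
  rw [altCoeff_monomial_stable hΛ hΛ' hra hsum]

end Stability

section Colorings

variable {n : ℕ} {K : Type*} [Fintype K] [DecidableEq K]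

theorem exists_coloring_of_content (M : K → ℕ) (hM : ∑ k, M k = n) :
    ∃ e : Fin n → K, ∀ k, (univ.filter fun x => e x = k).card = M k := by
  have hcard : Fintype.card (Fin n) = Fintype.card (Σ k, Fin (M k)) := by
    simp [hM]
  let E := Fintype.equivOfCardEq hcard
  refine ⟨fun x => (E x).1, fun k => ?_⟩
  rw [← Fintype.card_subtype]
  have e1 : {x // (E x).1 = k} ≃ {y : Σ k, Fin (M k) // y.1 = k} :=
    E.subtypeEquiv fun _ => Iff.rfl
  rw [Fintype.card_congr (e1.trans (Equiv.sigmaSubtype k)), Fintype.card_fin]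

omit [Fintype K] in
theorem exists_perm_of_content_eq {e e' : Fin n → K}
    (h : ∀ k, (univ.filter fun x => e x = k).card = (univ.filter fun x => e' x = k).card) :
    ∃ g : Equiv.Perm (Fin n), ∀ x, e' (g x) = e x := by
  have h' : ∀ k, Nonempty ({x // e x = k} ≃ {x // e' x = k}) := by
    intro k
    refine ⟨Fintype.equivOfCardEq ?_⟩
    rw [Fintype.card_subtype, Fintype.card_subtype, h k]
  exact ⟨Equiv.ofFiberEquiv fun k => (h' k).some, fun x => Equiv.ofFiberEquiv_map _ x⟩

/-- The permutations act transitively on the colorings of a given content, so by orbit counting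
the number of pairs of a permutation and an invariant coloring is the order of the group. -/
theorem sum_card_fixed_colorings (M : K → ℕ) (hM : ∑ k, M k = n) :
    ∑ w : Equiv.Perm (Fin n), (univ.filter fun e : Fin n → K =>
      (∀ x, e (w x) = e x) ∧ ∀ k, (univ.filter fun x => e x = k).card = M k).card =
      n.factorial := by
  obtain ⟨e₀, he₀⟩ := exists_coloring_of_content M hM
  set S : Finset (Fin n → K) :=
    univ.filter fun e => ∀ k, (univ.filter fun x => e x = k).card = M k with hS
  have h1 : ∀ w : Equiv.Perm (Fin n), (univ.filter fun e : Fin n → K =>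
      (∀ x, e (w x) = e x) ∧ ∀ k, (univ.filter fun x => e x = k).card = M k).card =
      ∑ e ∈ S, if ∀ x, e (w x) = e x then 1 else 0 := by
    intro w
    rw [← Finset.card_filter]
    congr 1
    ext e
    simp [hS, and_comm]
  rw [Finset.sum_congr rfl fun w _ => h1 w, Finset.sum_comm]
  have h2 : ∀ e ∈ S, (∑ w : Equiv.Perm (Fin n), if ∀ x, e (w x) = e x then 1 else 0) =
      (univ.filter fun g : Equiv.Perm (Fin n) => (fun x => e₀ (g x)) = e).card := by
    intro e he
    rw [hS, Finset.mem_filter] at he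
    obtain ⟨g, hg⟩ := exists_perm_of_content_eq (e := e) (e' := e₀)
      fun k => (he.2 k).trans (he₀ k).symm
    rw [← Finset.card_filter]
    refine Finset.card_bij (fun w _ => g * w) ?_ ?_ ?_
    · intro w hw
      rw [Finset.mem_filter] at hw ⊢
      refine ⟨mem_univ _, funext fun x => ?_⟩
      rw [Equiv.Perm.mul_apply, hg, hw.2]
    · intro w _ w' _ hww
      exact mul_left_cancel hww
    · intro g' hg'
      rw [Finset.mem_filter] at hg'
      refine ⟨g⁻¹ * g', ?_, by simp⟩
      rw [Finset.mem_filter]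
      refine ⟨mem_univ _, fun x => ?_⟩
      rw [← hg, Equiv.Perm.mul_apply, ← Equiv.Perm.mul_apply, mul_inv_cancel, Equiv.Perm.one_apply]
      exact congrFun hg'.2 x
  rw [Finset.sum_congr rfl h2, ← Finset.card_eq_sum_card_fiberwise, Finset.card_univ,
    Fintype.card_perm, Fintype.card_fin]
  intro g _
  rw [Finset.mem_coe, hS, Finset.mem_filter]
  refine ⟨mem_univ _, fun k => ?_⟩
  rw [← he₀ k]
  refine Finset.card_equiv g fun x => ?_
  simp

end Colorings

section Pairing

open MvPolynomial

variable {n : ℕ}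

/-- The unnormalized inner product of class functions. -/
def pairing (f g : Equiv.Perm (Fin n) → ℤ) : ℤ := ∑ w, f w * g w

theorem pairing_comm (f g : Equiv.Perm (Fin n) → ℤ) : pairing f g = pairing g f :=
  Finset.sum_congr rfl fun _ _ => mul_comm _ _

theorem pairing_sum_left {ι : Type*} (s : Finset ι) (c : ι → ℤ)
    (f : ι → Equiv.Perm (Fin n) → ℤ) (g : Equiv.Perm (Fin n) → ℤ) :
    pairing (fun w => ∑ i ∈ s, c i * f i w) g = ∑ i ∈ s, c i * pairing (f i) g := by
  simp only [pairing, Finset.sum_mul, Finset.mul_sum]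
  rw [Finset.sum_comm]
  exact Finset.sum_congr rfl fun _ _ => Finset.sum_congr rfl fun _ _ => by ring

theorem pairing_sum_right {ι : Type*} (s : Finset ι) (c : ι → ℤ)
    (f : ι → Equiv.Perm (Fin n) → ℤ) (g : Equiv.Perm (Fin n) → ℤ) :
    pairing g (fun w => ∑ i ∈ s, c i * f i w) = ∑ i ∈ s, c i * pairing g (f i) := by
  rw [pairing_comm, pairing_sum_left]
  exact Finset.sum_congr rfl fun _ _ => by rw [pairing_comm]

/-- The nonnegative integer matrices with row sums `a` and column sums `b`. -/
def contingency {q l : ℕ} (n : ℕ) (a : Fin q → ℤ) (b : Fin l → ℤ) :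
    Finset (Fin q × Fin l → ℕ) :=
  (Finset.piAntidiag univ n).filter fun M =>
    (∀ i, ∑ j, (M (i, j) : ℤ) = a i) ∧ ∀ j, ∑ i, (M (i, j) : ℤ) = b j

theorem youngChar_mul_youngChar {q l : ℕ} (a : Fin q → ℤ) (b : Fin l → ℤ)
    (w : Equiv.Perm (Fin n)) :
    youngChar a w * youngChar b w = ((univ.filter fun e : Fin n → Fin q × Fin l =>
      (∀ x, e (w x) = e x) ∧
        (∀ i, ((univ.filter fun x => (e x).1 = i).card : ℤ) = a i) ∧
        ∀ j, ((univ.filter fun x => (e x).2 = j).card : ℤ) = b j).card : ℤ) := by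
  rw [youngChar, youngChar, ← Nat.cast_mul, ← Finset.card_product]
  congr 1
  refine Finset.card_equiv (Equiv.arrowProdEquivProdArrow _ _ _).symm fun c => ?_
  simp only [Finset.mem_product, Finset.mem_filter, mem_univ, true_and,
    Equiv.arrowProdEquivProdArrow_symm_apply, Prod.ext_iff]
  constructor
  · rintro ⟨⟨h1, h2⟩, h3, h4⟩
    exact ⟨fun x => ⟨h1 x, h3 x⟩, h2, h4⟩
  · rintro ⟨h1, h2, h3⟩
    exact ⟨⟨fun x => (h1 x).1, h2⟩, fun x => (h1 x).2, h3⟩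

/-- The numbers of points of each color. -/
def content {K : Type*} [DecidableEq K] (e : Fin n → K) (k : K) : ℕ :=
  (univ.filter fun x => e x = k).card

theorem pairing_youngChar {q l : ℕ} (a : Fin q → ℤ) (b : Fin l → ℤ) :
    pairing (n := n) (youngChar a) (youngChar b) = n.factorial * (contingency n a b).card := by
  have h1 : ∀ w : Equiv.Perm (Fin n), youngChar a w * youngChar b w =
      ∑ M ∈ contingency n a b, (((univ.filter fun e : Fin n → Fin q × Fin l =>
        (∀ x, e (w x) = e x) ∧ ∀ k, (univ.filter fun x => e x = k).card = M k).card : ℕ) : ℤ) := by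
    intro w
    rw [youngChar_mul_youngChar, ← Nat.cast_sum]
    congr 1
    have hfib : ∀ M : Fin q × Fin l → ℕ, (univ.filter fun e : Fin n → Fin q × Fin l =>
        (∀ x, e (w x) = e x) ∧ ∀ k, (univ.filter fun x => e x = k).card = M k) =
        (univ.filter fun e : Fin n → Fin q × Fin l => ∀ x, e (w x) = e x).filter
          fun e => content e = M := by
      intro M
      rw [Finset.filter_filter]
      refine Finset.filter_congr fun e _ => ?_
      rw [funext_iff]
      rfl
    rw [Finset.sum_congr rfl fun M _ => congrArg Finset.card (hfib M),
      Finset.sum_card_fiberwise_eq_card_filter, Finset.filter_filter]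
    have hrow : ∀ (e : Fin n → Fin q × Fin l) (i : Fin q),
        ∑ j, (univ.filter fun x => e x = (i, j)).card = (univ.filter fun x => (e x).1 = i).card := by
      intro e i
      rw [Finset.card_eq_sum_card_fiberwise (f := fun x => (e x).2) (t := univ)
        (fun _ _ => mem_coe.mpr (mem_univ _))]
      refine Finset.sum_congr rfl fun j _ => ?_
      congr 1
      ext x
      simp [Prod.ext_iff]
    have hcol : ∀ (e : Fin n → Fin q × Fin l) (j : Fin l),
        ∑ i, (univ.filter fun x => e x = (i, j)).card = (univ.filter fun x => (e x).2 = j).card := by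
      intro e j
      rw [Finset.card_eq_sum_card_fiberwise (f := fun x => (e x).1) (t := univ)
        (fun _ _ => mem_coe.mpr (mem_univ _))]
      refine Finset.sum_congr rfl fun i _ => ?_
      congr 1
      ext x
      simp [Prod.ext_iff, and_comm]
    have htot : ∀ (e : Fin n → Fin q × Fin l),
        ∑ k, (univ.filter fun x => e x = k).card = n := by
      intro e
      rw [← Finset.card_eq_sum_card_fiberwise (fun _ _ => mem_coe.mpr (mem_univ _))]
      simp
    have hcont : ∀ e : Fin n → Fin q × Fin l,
        content e ∈ contingency n a b ↔
        (∀ i, ((univ.filter fun x => (e x).1 = i).card : ℤ) = a i) ∧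
        ∀ j, ((univ.filter fun x => (e x).2 = j).card : ℤ) = b j := by
      intro e
      simp only [contingency, content, Finset.mem_filter, Finset.mem_piAntidiag, mem_univ,
        implies_true, and_true, ← Nat.cast_sum, hrow, hcol]
      exact and_iff_right (htot e)
    congr 1
    refine Finset.filter_congr fun e _ => ?_
    rw [hcont]
  rw [pairing, Finset.sum_congr rfl fun w _ => h1 w, Finset.sum_comm, mul_comm, ← nsmul_eq_mul,
    ← Finset.sum_const]
  refine Finset.sum_congr rfl fun M hM => ?_
  rw [← Nat.cast_sum, sum_card_fixed_colorings]
  rw [contingency, Finset.mem_filter, Finset.mem_piAntidiag] at hM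
  exact hM.1.1

theorem completeHom_X_natCast {l : ℕ} (a : ℕ) :
    completeHom (X : Fin l → MvPolynomial (Fin l) ℤ) a =
      ∑ γ ∈ Finset.piAntidiag univ a, monomial (Finsupp.equivFunOnFinite.symm γ) 1 := by
  rw [completeHom_natCast, PowerSeries.coeff_prod]
  refine Finset.sum_bij (fun γ _ => (γ : Fin l → ℕ)) ?_ ?_ ?_ ?_
  · intro γ hγ
    rw [Finset.mem_finsuppAntidiag] at hγ
    simpa [Finset.mem_piAntidiag] using hγ.1
  · intro γ _ γ' _ h
    exact DFunLike.coe_injective h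
  · intro γ hγ
    refine ⟨Finsupp.equivFunOnFinite.symm γ, ?_, rfl⟩
    rw [Finset.mem_piAntidiag] at hγ
    simpa [Finset.mem_finsuppAntidiag] using hγ.1
  · intro γ _
    rw [monomial_eq, Finsupp.prod_fintype _ _ (fun i => pow_zero _)]
    simp

theorem coeffZ_prod_completeHom {q l : ℕ} (a : Fin q → ℤ) (ha : ∑ i, a i = n) (b : Fin l → ℤ) :
    coeffZ (∏ i, completeHom X (a i)) b = (contingency n a b).card := by
  by_cases hneg : ∃ i, a i < 0
  · obtain ⟨i, hi⟩ := hneg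
    rw [Finset.prod_eq_zero (mem_univ i) (completeHom_of_neg _ hi)]
    have : contingency n a b = ∅ := by
      rw [Finset.eq_empty_iff_forall_notMem]
      intro M hM
      rw [contingency, Finset.mem_filter] at hM
      have h1 := hM.2.1 i
      have h2 : 0 ≤ ∑ j, (M (i, j) : ℤ) := Finset.sum_nonneg fun _ _ => by positivity
      omega
    rw [this]
    simp [coeffZ]
  push Not at hneg
  by_cases hb : ∀ j, 0 ≤ b j
  swap
  · rw [coeffZ, if_neg hb]
    push Not at hb
    obtain ⟨j, hj⟩ := hb
    have : contingency n a b = ∅ := by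
      rw [Finset.eq_empty_iff_forall_notMem]
      intro M hM
      rw [contingency, Finset.mem_filter] at hM
      have h1 := hM.2.2 j
      have h2 : 0 ≤ ∑ i, (M (i, j) : ℤ) := Finset.sum_nonneg fun _ _ => by positivity
      omega
    rw [this]
    simp
  have hprod : (∏ i, completeHom (X : Fin l → MvPolynomial (Fin l) ℤ) (a i)) =
      ∑ p ∈ Fintype.piFinset fun i => Finset.piAntidiag univ (a i).toNat,
        monomial (∑ i, Finsupp.equivFunOnFinite.symm (p i)) 1 := by
    have h1 : ∀ i, completeHom (X : Fin l → MvPolynomial (Fin l) ℤ) (a i) =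
        ∑ γ ∈ Finset.piAntidiag univ (a i).toNat,
          monomial (Finsupp.equivFunOnFinite.symm γ) 1 := by
      intro i
      rw [← completeHom_X_natCast, Int.toNat_of_nonneg (hneg i)]
    rw [Finset.prod_congr rfl fun i _ => h1 i, Finset.prod_univ_sum]
    refine Finset.sum_congr rfl fun p _ => ?_
    rw [monomial_sum_index]
    simp
  rw [coeffZ, if_pos hb, hprod, coeff_sum]
  simp only [coeff_monomial]
  rw [Finset.sum_boole]
  congr 1
  have hcol : ∀ p : Fin q → Fin l → ℕ, (∑ i, Finsupp.equivFunOnFinite.symm (p i) =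
      Finsupp.equivFunOnFinite.symm fun j => (b j).toNat) ↔ ∀ j, ∑ i, (p i j : ℤ) = b j := by
    intro p
    rw [DFunLike.ext_iff]
    refine forall_congr' fun j => ?_
    simp only [Finsupp.finsetSum_apply, Finsupp.equivFunOnFinite_symm_apply_apply]
    have := hb j
    rw [← Nat.cast_sum]
    omega
  have hrow : ∀ p : Fin q → Fin l → ℕ,
      (p ∈ Fintype.piFinset fun i => Finset.piAntidiag univ (a i).toNat) ↔
        ∀ i, ∑ j, (p i j : ℤ) = a i := by
    intro p
    rw [Fintype.mem_piFinset]
    refine forall_congr' fun i => ?_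
    simp only [Finset.mem_piAntidiag, mem_univ, implies_true, and_true]
    change ∑ j, p i j = _ ↔ _
    have := hneg i
    rw [← Nat.cast_sum]
    omega
  refine Finset.card_bij' (fun p _ k => p k.1 k.2) (fun M _ i j => M (i, j)) ?_ ?_
    (fun _ _ => rfl) (fun _ _ => rfl)
  · intro p hp
    rw [Finset.mem_filter, hcol, hrow] at hp
    rw [contingency, Finset.mem_filter, Finset.mem_piAntidiag]
    refine ⟨⟨?_, fun _ _ => mem_univ _⟩, hp⟩
    rw [← Nat.cast_inj (R := ℤ), ← ha, Nat.cast_sum, Fintype.sum_prod_type]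
    exact Finset.sum_congr rfl fun i _ => hp.1 i
  · intro M hM
    rw [contingency, Finset.mem_filter] at hM
    rw [Finset.mem_filter, hcol, hrow]
    exact hM.2

/-- `P` is the Frobenius characteristic of `f` in the variables `x_1, …, x_l`: its coefficients
are the inner products of `f` with the Young permutation characters. -/
def HasFrobenius {l : ℕ} (f : Equiv.Perm (Fin n) → ℤ) (P : MvPolynomial (Fin l) ℤ) : Prop :=
  ∀ b : Fin l → ℤ, pairing f (youngChar b) = n.factorial * coeffZ P b

theorem hasFrobenius_youngChar {q l : ℕ} (a : Fin q → ℤ) (ha : ∑ i, a i = n) :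
    HasFrobenius (n := n) (youngChar a)
      (∏ i, completeHom (X : Fin l → MvPolynomial (Fin l) ℤ) (a i)) := fun b => by
  rw [pairing_youngChar, coeffZ_prod_completeHom a ha]

theorem HasFrobenius.sum {l : ℕ} {ι : Type*} {s : Finset ι} (c : ι → ℤ)
    {f : ι → Equiv.Perm (Fin n) → ℤ} {P : ι → MvPolynomial (Fin l) ℤ}
    (h : ∀ i ∈ s, HasFrobenius (f i) (P i)) :
    HasFrobenius (fun w => ∑ i ∈ s, c i * f i w) (∑ i ∈ s, c i • P i) := fun b => by
  rw [pairing_sum_left, coeffZ_sum, Finset.mul_sum]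
  refine Finset.sum_congr rfl fun i hi => ?_
  rw [h i hi b, coeffZ_smul]
  ring

/-- The class function with Frobenius characteristic `det (h_{α_i - i + j})`. -/
def schurChar {q : ℕ} (α : Fin q → ℤ) (w : Equiv.Perm (Fin n)) : ℤ :=
  ∑ σ : Equiv.Perm (Fin q), (Equiv.Perm.sign σ : ℤ) *
    youngChar (fun i => α i - (i : ℕ) + (σ i : ℕ)) w

/-- The class function with Frobenius characteristic `h_a det (h_{α_i - i + j})`. -/
def inducedSchurChar {q : ℕ} (a : ℤ) (α : Fin q → ℤ) (w : Equiv.Perm (Fin n)) : ℤ :=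
  ∑ σ : Equiv.Perm (Fin q), (Equiv.Perm.sign σ : ℤ) *
    youngChar (Fin.cons a fun i => α i - (i : ℕ) + (σ i : ℕ) : Fin (q + 1) → ℤ) w

theorem sum_sub_val_add_perm {q : ℕ} (α : Fin q → ℤ) (σ : Equiv.Perm (Fin q)) :
    ∑ i, (α i - (i : ℕ) + (σ i : ℕ)) = ∑ i, α i := by
  rw [Finset.sum_add_distrib, Finset.sum_sub_distrib,
    Equiv.sum_comp σ fun i : Fin q => ((i : ℕ) : ℤ)]
  ring

theorem jacobiTrudi_eq_sum {R : Type*} [CommRing R] {q l : ℕ} (x : Fin l → R) (α : Fin q → ℤ) :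
    jacobiTrudi x α = ∑ σ : Equiv.Perm (Fin q), (Equiv.Perm.sign σ : ℤ) •
      ∏ i, completeHom x (α i - (i : ℕ) + (σ i : ℕ)) := by
  rw [jacobiTrudi, ← Matrix.det_transpose, Matrix.det_apply]
  rfl

theorem hasFrobenius_schurChar {q l : ℕ} (α : Fin q → ℤ) (hα : ∑ i, α i = n) :
    HasFrobenius (n := n) (schurChar α)
      (jacobiTrudi (X : Fin l → MvPolynomial (Fin l) ℤ) α) := by
  rw [jacobiTrudi_eq_sum]
  exact HasFrobenius.sum _ fun σ _ =>
    hasFrobenius_youngChar _ ((sum_sub_val_add_perm α σ).trans hα)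

theorem hasFrobenius_inducedSchurChar {q l : ℕ} (a : ℤ) (α : Fin q → ℤ)
    (hα : a + ∑ i, α i = n) :
    HasFrobenius (n := n) (inducedSchurChar a α)
      (completeHom X a * jacobiTrudi (X : Fin l → MvPolynomial (Fin l) ℤ) α) := by
  rw [jacobiTrudi_eq_sum, Finset.mul_sum]
  simp only [mul_smul_comm]
  refine HasFrobenius.sum _ fun σ _ => ?_
  have h := hasFrobenius_youngChar (n := n) (l := l)
    (Fin.cons a fun i => α i - (i : ℕ) + (σ i : ℕ) : Fin (q + 1) → ℤ) (by
      rw [Fin.sum_univ_succ]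
      simp only [Fin.cons_zero, Fin.cons_succ]
      rw [sum_sub_val_add_perm, hα])
  rw [Fin.prod_univ_succ] at h
  simpa only [Fin.cons_zero, Fin.cons_succ] using h

theorem HasFrobenius.pairing_schurChar {l : ℕ} {f : Equiv.Perm (Fin n) → ℤ}
    {P : MvPolynomial (Fin l) ℤ} (h : HasFrobenius f P) (Λ : Fin l → ℤ) :
    pairing f (schurChar Λ) = n.factorial * altCoeff Λ P := by
  have h1 : pairing f (schurChar Λ) = _ := pairing_sum_right univ _ _ f
  rw [h1, altCoeff, Finset.mul_sum]
  refine Finset.sum_congr rfl fun σ _ => ?_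
  rw [h]
  ring

/-- The orthogonality relations for the irreducible characters. -/
theorem pairing_schurChar_schurChar {q p : ℕ} (hqp : q ≤ p) (α : Fin q → ℤ) (Λ : Fin p → ℤ)
    (hα : ∀ i, 0 < α i) (hΛ : ∀ i, 0 < Λ i) (hα' : Antitone α) (hΛ' : Antitone Λ)
    (hsum : ∑ i, α i = n) :
    pairing (n := n) (schurChar α) (schurChar Λ) =
      if ∃ h : q = p, ∀ i, α i = Λ (Fin.cast h i) then (n.factorial : ℤ) else 0 := by
  rw [(hasFrobenius_schurChar (l := p) α hsum).pairing_schurChar]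
  set γ : Fin p → ℤ := fun i => if h : (i : ℕ) < q then α ⟨i, h⟩ else 0 with hγ
  have h1 : jacobiTrudi (X : Fin p → MvPolynomial (Fin p) ℤ) α = jacobiTrudi X γ := by
    rw [jacobiTrudi_append_zero hqp X γ fun i hi => by simp [hγ, not_lt.mpr hi]]
    congr 1
    funext i
    simp [hγ]
  have hγ0 : ∀ i, 0 ≤ γ i := by
    intro i
    simp only [hγ]
    split_ifs with h
    · exact (hα _).le
    · exact le_rfl
  have hγ' : Antitone γ := by
    intro i j hij
    have hij' : (i : ℕ) ≤ j := hij
    by_cases hj : (j : ℕ) < q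
    · simp only [hγ, dif_pos hj, dif_pos (lt_of_le_of_lt hij' hj)]
      exact hα' hij'
    · have : γ j = 0 := by simp only [hγ, dif_neg hj]
      rw [this]
      exact hγ0 i
  rw [h1, altCoeff_jacobiTrudi (fun i => (hΛ i).le) hγ0 hΛ' hγ']
  have h2 : Λ = γ ↔ ∃ h : q = p, ∀ i, α i = Λ (Fin.cast h i) := by
    constructor
    · intro h
      have hq : q = p := by
        by_contra hne
        have := hΛ ⟨q, by omega⟩
        rw [h] at this
        simp [hγ] at this
      subst hq
      refine ⟨rfl, fun i => ?_⟩
      rw [h]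
      simp [hγ]
    · rintro ⟨rfl, h⟩
      funext i
      simp [hγ, h]
  rw [if_congr h2 rfl rfl]
  split_ifs <;> simp

end Pairing

section Lists

variable {n : ℕ}

theorem sum_get_cast (L : List ℕ) : ∑ i, (L.get i : ℤ) = L.sum := by
  rw [← Nat.cast_sum]
  congr 1
  exact (Fin.sum_univ_fun_getElem L id).trans (by simp)

theorem pairing_irrChar_aux {L L' : List ℕ} (h : L.SortedGE) (h' : L'.SortedGE)
    (hpos : ∀ a ∈ L, 0 < a) (hpos' : ∀ a ∈ L', 0 < a) (hsum : L.sum = n)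
    (hlen : L.length ≤ L'.length) :
    pairing (n := n) (irrChar L) (irrChar L') = if L = L' then (n.factorial : ℤ) else 0 := by
  have key := pairing_schurChar_schurChar (n := n) hlen (fun i => (L.get i : ℤ))
    (fun i => (L'.get i : ℤ))
    (fun i => by exact_mod_cast hpos _ (List.get_mem _ _))
    (fun i => by exact_mod_cast hpos' _ (List.get_mem _ _))
    (fun i j hij => Nat.cast_le.mpr (h.antitone_get hij))
    (fun i j hij => Nat.cast_le.mpr (h'.antitone_get hij))
    (by rw [sum_get_cast, hsum])
  refine key.trans (if_congr ?_ rfl rfl)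
  constructor
  · rintro ⟨hl, hg⟩
    refine List.ext_get hl fun i h1 h2 => ?_
    have := hg ⟨i, h1⟩
    exact_mod_cast this
  · rintro rfl
    exact ⟨rfl, fun i => rfl⟩

/-- Orthogonality of the irreducible characters, indexed by weakly decreasing lists. -/
theorem pairing_irrChar {L L' : List ℕ} (h : L.SortedGE) (h' : L'.SortedGE)
    (hpos : ∀ a ∈ L, 0 < a) (hpos' : ∀ a ∈ L', 0 < a) (hsum : L.sum = n) (hsum' : L'.sum = n) :
    pairing (n := n) (irrChar L) (irrChar L') = if L = L' then (n.factorial : ℤ) else 0 := by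
  rcases le_total L.length L'.length with hl | hl
  · exact pairing_irrChar_aux h h' hpos hpos' hsum hl
  · rw [pairing_comm, pairing_irrChar_aux h' h hpos' hpos hsum' hl, if_congr eq_comm rfl rfl]

theorem rows_sortedGE (p : n.Partition) : (rows p).SortedGE :=
  (Multiset.pairwise_sort _ _).sortedGE

theorem mem_rows_pos (p : n.Partition) : ∀ a ∈ rows p, 0 < a := fun _ ha =>
  p.parts_pos ((Multiset.mem_sort _).mp ha)

theorem rows_sum (p : n.Partition) : (rows p).sum = n := by
  rw [← Multiset.sum_coe, rows, Multiset.sort_eq, p.parts_sum]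

theorem rows_injective : Function.Injective (rows : n.Partition → List ℕ) := by
  intro p q h
  ext1
  rw [← Multiset.sort_eq p.parts (· ≥ ·), ← Multiset.sort_eq q.parts (· ≥ ·)]
  exact congrArg _ h

/-- Every weakly decreasing list of positive integers is the list of parts of a partition. -/
theorem exists_rows_eq {L : List ℕ} (h : L.SortedGE) (hpos : ∀ a ∈ L, 0 < a)
    (hsum : L.sum = n) : ∃ p : n.Partition, rows p = L := by
  refine ⟨⟨L, fun {i} hi => hpos i (Multiset.mem_coe.mp hi), by rw [Multiset.sum_coe, hsum]⟩, ?_⟩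
  rw [rows, Multiset.coe_sort]
  exact List.mergeSort_eq_self _ (h.pairwise.imp fun h => by simpa using h)

theorem pairing_irrChar_rows (p q : n.Partition) :
    pairing (n := n) (irrChar (rows p)) (irrChar (rows q)) =
      if p = q then (n.factorial : ℤ) else 0 := by
  rw [pairing_irrChar (rows_sortedGE p) (rows_sortedGE q) (mem_rows_pos p) (mem_rows_pos q)
    (rows_sum p) (rows_sum q), if_congr rows_injective.eq_iff rfl rfl]

end Lists

section Completeness

variable {n : ℕ}

/-- Class functions on the symmetric group. -/
def IsClassFunction (f : Equiv.Perm (Fin n) → ℤ) : Prop := ∀ u v, f (u * v * u⁻¹) = f v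

theorem isClassFunction_youngChar {l : ℕ} (α : Fin l → ℤ) :
    IsClassFunction (n := n) (youngChar α) := by
  intro u v
  rw [youngChar, youngChar]
  congr 1
  refine Finset.card_equiv (Equiv.arrowCongr u⁻¹ (Equiv.refl _)) fun e => ?_
  simp only [Finset.mem_filter, mem_univ, true_and, Equiv.arrowCongr_apply, Equiv.coe_refl,
    Function.comp_apply, id_eq]
  have hinv : (u⁻¹ : Equiv.Perm (Fin n)).symm = u := rfl
  rw [hinv]
  refine and_congr ⟨fun h x => ?_, fun h x => ?_⟩ (forall_congr' fun j => ?_)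
  · simpa using h (u x)
  · simpa using h (u⁻¹ x)
  · rw [show (univ.filter fun x => e x = j).card = (univ.filter fun x => e (u x) = j).card from
      (Finset.card_equiv u fun x => by simp).symm]

theorem IsClassFunction.sum {ι : Type*} {s : Finset ι} (c : ι → ℤ)
    {f : ι → Equiv.Perm (Fin n) → ℤ} (h : ∀ i ∈ s, IsClassFunction (f i)) :
    IsClassFunction fun w => ∑ i ∈ s, c i * f i w := fun u v =>
  Finset.sum_congr rfl fun i hi => by rw [h i hi u v]

theorem isClassFunction_irrChar (L : List ℕ) : IsClassFunction (n := n) (irrChar L) :=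
  IsClassFunction.sum _ fun _ _ => isClassFunction_youngChar _

theorem isClassFunction_inducedSchurChar {q : ℕ} (a : ℤ) (α : Fin q → ℤ) :
    IsClassFunction (n := n) (inducedSchurChar a α) :=
  IsClassFunction.sum _ fun _ _ => isClassFunction_youngChar _

theorem IsClassFunction.eq_of_isConj {f : Equiv.Perm (Fin n) → ℤ} (hf : IsClassFunction f)
    {v w : Equiv.Perm (Fin n)} (h : IsConj v w) : f v = f w := by
  obtain ⟨c, hc⟩ := isConj_iff.mp h
  rw [← hc, hf]

open scoped Classical in
theorem card_conjClasses_le :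
    Fintype.card (ConjClasses (Equiv.Perm (Fin n))) ≤ Fintype.card n.Partition := by
  have h : Fintype.card n.Partition = Fintype.card (Fintype.card (Fin n)).Partition := by
    rw [Fintype.card_fin]
  rw [h]
  refine Fintype.card_le_of_injective
    (Quotient.lift (fun w : Equiv.Perm (Fin n) => w.partition)
      fun v w h => Equiv.Perm.partition_eq_of_isConj.mp h) ?_
  rintro ⟨v⟩ ⟨w⟩ h
  exact Quotient.sound (Equiv.Perm.partition_eq_of_isConj.mpr h)

open scoped Classical in
/-- The irreducible characters span the class functions: they are orthogonal, and there are at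
least as many of them as conjugacy classes. -/
theorem IsClassFunction.factorial_mul_eq {f : Equiv.Perm (Fin n) → ℤ} (hf : IsClassFunction f)
    (v : Equiv.Perm (Fin n)) :
    n.factorial * f v =
      ∑ p : n.Partition, pairing f (irrChar (rows p)) * irrChar (rows p) v := by
  set C := ConjClasses (Equiv.Perm (Fin n)) with hC
  have hfac : (n.factorial : ℚ) ≠ 0 := by positivity
  have hout : ∀ g : Equiv.Perm (Fin n) → ℤ, IsClassFunction g → ∀ w,
      g (Quotient.out (ConjClasses.mk w : C)) = g w := by
    intro g hg w
    exact hg.eq_of_isConj (ConjClasses.mk_eq_mk_iff_isConj.mp (Quotient.out_eq _))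
  let A : Matrix n.Partition C ℚ := fun p c =>
    (∑ w, if ConjClasses.mk w = c then (irrChar (rows p) w : ℚ) else 0) / n.factorial
  let B : Matrix C n.Partition ℚ := fun c p => irrChar (rows p) (Quotient.out c)
  have hAB : A * B = 1 := by
    ext p q
    rw [Matrix.mul_apply, Matrix.one_apply]
    have h1 : ∑ c, A p c * B c q =
        (pairing (n := n) (irrChar (rows p)) (irrChar (rows q)) : ℚ) / n.factorial := by
      simp only [A, B, div_mul_eq_mul_div, Finset.sum_mul]
      rw [← Finset.sum_div, Finset.sum_comm]
      congr 1
      rw [pairing, Int.cast_sum]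
      refine Finset.sum_congr rfl fun w _ => ?_
      rw [Finset.sum_eq_single (ConjClasses.mk w)]
      · rw [if_pos rfl, hout _ (isClassFunction_irrChar _), Int.cast_mul]
      · intro c _ hc
        rw [if_neg (Ne.symm hc), zero_mul]
      · simp
    rw [h1, pairing_irrChar_rows]
    split_ifs
    · rw [Int.cast_natCast, div_self hfac]
    · simp
  have hcard : Fintype.card n.Partition = Fintype.card C := by
    refine le_antisymm ?_ card_conjClasses_le
    have h1 := Matrix.rank_mul_le_left A B
    rw [hAB, Matrix.rank_one] at h1
    exact h1.trans (Matrix.rank_le_card_width A)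
  have hBA : B * A = 1 := (Matrix.mul_eq_one_comm_of_equiv (Fintype.equivOfCardEq hcard)).mp hAB
  have hpair : ∀ p : n.Partition, (pairing f (irrChar (rows p)) : ℚ) =
      ∑ c : C, (f (Quotient.out c) : ℚ) * (A p c * n.factorial) := by
    intro p
    simp only [A, div_mul_cancel₀ _ hfac, Finset.mul_sum]
    rw [Finset.sum_comm, pairing, Int.cast_sum]
    refine Finset.sum_congr rfl fun w _ => ?_
    rw [Finset.sum_eq_single (ConjClasses.mk w)]
    · rw [if_pos rfl, hout _ hf, Int.cast_mul]
    · intro c _ hc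
      rw [if_neg (Ne.symm hc), mul_zero]
    · simp
  have hmain : ((n.factorial * f v : ℤ) : ℚ) =
      ((∑ p : n.Partition, pairing f (irrChar (rows p)) * irrChar (rows p) v : ℤ) : ℚ) := by
    push_cast
    simp only [hpair, Finset.sum_mul]
    rw [Finset.sum_comm]
    have h2 : ∀ c : C, ∑ p : n.Partition, (f (Quotient.out c) : ℚ) * (A p c * n.factorial) *
        irrChar (rows p) v =
        f (Quotient.out c) * n.factorial * (B * A) (ConjClasses.mk v) c := by
      intro c
      rw [Matrix.mul_apply, Finset.mul_sum]
      refine Finset.sum_congr rfl fun p _ => ?_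
      simp only [B]
      rw [hout _ (isClassFunction_irrChar _)]
      ring
    rw [Finset.sum_congr rfl fun c _ => h2 c, hBA,
      Finset.sum_eq_single (ConjClasses.mk v : C)]
    · rw [Matrix.one_apply_eq, hout _ hf]
      ring
    · intro c _ hc
      rw [Matrix.one_apply_ne (Ne.symm hc), mul_zero]
    · simp
  exact_mod_cast hmain

/-- An integral class function whose inner products with the Young permutation characters are
integers is an integral combination of the irreducible characters. -/
theorem IsClassFunction.exists_eq_sum {f : Equiv.Perm (Fin n) → ℤ} (hf : IsClassFunction f)
    (hdvd : ∀ (l : ℕ) (α : Fin l → ℤ), (n.factorial : ℤ) ∣ pairing f (youngChar α)) :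
    ∃ a : n.Partition → ℤ, ∀ w, f w = ∑ p, a p * irrChar (rows p) w := by
  have h1 : ∀ p : n.Partition, (n.factorial : ℤ) ∣ pairing f (irrChar (rows p)) := by
    intro p
    have h2 : pairing f (irrChar (rows p)) = _ := pairing_sum_right univ _ _ f
    rw [h2]
    exact Finset.dvd_sum fun σ _ => Dvd.dvd.mul_left (hdvd _ _) _
  choose a ha using h1
  refine ⟨a, fun w => ?_⟩
  have hfac : (n.factorial : ℤ) ≠ 0 := by positivity
  refine mul_left_cancel₀ hfac ?_
  rw [hf.factorial_mul_eq, Finset.mul_sum]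
  refine Finset.sum_congr rfl fun p _ => ?_
  rw [ha, mul_assoc]

end Completeness

open MvPolynomial

section Decomposition

variable {n : ℕ}

/-- The multiplicity of the irreducible character with rows `L` in
`∑_{r ≤ R} h_{n-r} ∑_p a_{r,p} s_p`. -/
noncomputable def inducedMult (R : ℕ) (a : ∀ r : ℕ, r.Partition → ℤ) (n : ℕ) (L : List ℕ) : ℤ :=
  ∑ r ∈ range (R + 1), ∑ p : r.Partition, a r p *
    altCoeff (fun i => (L.get i : ℤ))
      (completeHom X ((n : ℤ) - r) * jacobiTrudi X fun i => ((rows p).get i : ℤ))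

theorem pairing_inducedSchurChar (r : ℕ) (p : r.Partition) (L : List ℕ) :
    pairing (n := n) (inducedSchurChar ((n : ℤ) - r) fun i => ((rows p).get i : ℤ)) (irrChar L) =
      n.factorial * altCoeff (fun i => (L.get i : ℤ))
        (completeHom X ((n : ℤ) - r) * jacobiTrudi X fun i => ((rows p).get i : ℤ)) := by
  refine HasFrobenius.pairing_schurChar (hasFrobenius_inducedSchurChar _ _ ?_) _
  rw [sum_get_cast, rows_sum]
  ring

variable {R : ℕ} {a : ∀ r : ℕ, r.Partition → ℤ} {f : Equiv.Perm (Fin n) → ℤ}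

theorem pairing_eq_inducedMult (h : ∀ w, f w = ∑ r ∈ range (R + 1), ∑ p : r.Partition,
      a r p * inducedSchurChar ((n : ℤ) - r) (fun i => ((rows p).get i : ℤ)) w) (L : List ℕ) :
    pairing f (irrChar L) = n.factorial * inducedMult R a n L := by
  have h1 : f = fun w => ∑ r ∈ range (R + 1), 1 * ∑ p : r.Partition,
      a r p * inducedSchurChar ((n : ℤ) - r) (fun i => ((rows p).get i : ℤ)) w := by
    funext w
    simp only [h, one_mul]
  rw [h1, pairing_sum_left, inducedMult, Finset.mul_sum]
  refine Finset.sum_congr rfl fun r _ => ?_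
  rw [one_mul, pairing_sum_left, Finset.mul_sum]
  refine Finset.sum_congr rfl fun p _ => ?_
  rw [pairing_inducedSchurChar]
  ring

theorem eq_sum_inducedMult (h : ∀ w, f w = ∑ r ∈ range (R + 1), ∑ p : r.Partition,
      a r p * inducedSchurChar ((n : ℤ) - r) (fun i => ((rows p).get i : ℤ)) w)
    (w : Equiv.Perm (Fin n)) :
    f w = ∑ p : n.Partition, inducedMult R a n (rows p) * irrChar (rows p) w := by
  have hf : IsClassFunction f := by
    intro u v
    rw [h, h]
    refine Finset.sum_congr rfl fun r _ => Finset.sum_congr rfl fun p _ => ?_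
    rw [isClassFunction_inducedSchurChar]
  have hfac : (n.factorial : ℤ) ≠ 0 := by positivity
  refine mul_left_cancel₀ hfac ?_
  rw [hf.factorial_mul_eq, Finset.mul_sum]
  refine Finset.sum_congr rfl fun p _ => ?_
  rw [pairing_eq_inducedMult h, mul_assoc]

end Decomposition

section Stability

theorem inducedMult_addFirstRow {R N : ℕ} (a : ∀ r : ℕ, r.Partition → ℤ) (hN : 2 * R ≤ N)
    {b : ℕ} {L : List ℕ} (h : (b :: L).SortedGE) (hsum : (b :: L).sum = N) (m : ℕ) :
    inducedMult R a (N + m) ((b + m) :: L) = inducedMult R a N (b :: L) := by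
  refine Finset.sum_congr rfl fun r hr => Finset.sum_congr rfl fun p _ => ?_
  rw [Finset.mem_range] at hr
  refine congrArg (a r p * ·) ?_
  have hs := sum_get_cast (b :: L)
  rw [hsum] at hs
  have key := altCoeff_stable (q := L.length) (Λ := fun i => ((b :: L).get i : ℤ))
    (fun i => by positivity) (fun i j hij => Nat.cast_le.mpr (h.antitone_get hij))
    (a := N - r) (r := r) (by omega) (hs.trans (by omega)) m
    (jacobiTrudi X fun i => ((rows p).get i : ℤ))
  have e1 : (((N - r + m : ℕ) : ℕ) : ℤ) = ((N + m : ℕ) : ℤ) - r := by omega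
  have e2 : (((N - r : ℕ) : ℕ) : ℤ) = (N : ℤ) - r := by omega
  have e3 : (fun k : Fin (L.length + 1) =>
      if k = 0 then ((b :: L).get k : ℤ) + m else ((b :: L).get k : ℤ)) =
      fun k => (((b + m) :: L).get k : ℤ) := by
    funext k
    refine Fin.cases ?_ (fun j => ?_) k
    · rw [if_pos rfl]
      exact (Nat.cast_add b m).symm
    · rw [if_neg (Fin.succ_ne_zero j)]
      rfl
  rw [e1, e2, e3] at key
  exact key

theorem inducedMult_eq_zero {R n : ℕ} (a : ∀ r : ℕ, r.Partition → ℤ) (hn : 2 * R ≤ n)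
    {b : ℕ} {L : List ℕ} (h : (b :: L).SortedGE) (hsum : (b :: L).sum = n) (hb : b + R < n) :
    inducedMult R a n (b :: L) = 0 := by
  refine Finset.sum_eq_zero fun r hr => Finset.sum_eq_zero fun p _ => ?_
  rw [Finset.mem_range] at hr
  have hs := sum_get_cast (b :: L)
  rw [hsum] at hs
  have key := altCoeff_eq_zero (q := L.length) (Λ := fun i => ((b :: L).get i : ℤ))
    (fun i => by positivity) (fun i j hij => Nat.cast_le.mpr (h.antitone_get hij))
    (a := n - r) (r := r) (by omega) (hs.trans (by omega))
    (by
      change (b : ℤ) < _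
      omega)
    (jacobiTrudi X fun i => ((rows p).get i : ℤ))
  have e2 : (((n - r : ℕ) : ℕ) : ℤ) = (n : ℤ) - r := by omega
  rw [e2] at key
  exact (congrArg (a r p * ·) key).trans (mul_zero _)

/-- A sequence `∑_{r ≤ R} h_{n-r} f_r`, with `f_r` a virtual character of `S_r`,
stabilizes beyond `2 R`. -/
theorem stabilizesBeyond_of_eq_sum (χ : ∀ n : ℕ, Equiv.Perm (Fin n) → ℤ) {R N : ℕ}
    (hN : 2 * R ≤ N) (hN0 : 0 < N) (a : ∀ r : ℕ, r.Partition → ℤ)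
    (h : ∀ n, N ≤ n → ∀ w, χ n w = ∑ r ∈ range (R + 1), ∑ p : r.Partition,
      a r p * inducedSchurChar ((n : ℤ) - r) (fun i => ((rows p).get i : ℤ)) w) :
    StabilizesBeyond χ N := by
  refine ⟨fun p => inducedMult R a N (rows p), eq_sum_inducedMult (h N le_rfl), ?_⟩
  intro m w
  rw [eq_sum_inducedMult (h (N + m) (by omega))]
  have hcons : ∀ {n : ℕ}, 0 < n → ∀ p : n.Partition, ∃ b L, rows p = b :: L := by
    intro n hn p
    have h1 := rows_sum p
    rcases h2 : rows p with _ | ⟨b, L⟩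
    · rw [h2, List.sum_nil] at h1
      omega
    · exact ⟨b, L, rfl⟩
  have hφ : ∀ p : N.Partition, ∃ q : (N + m).Partition, rows q = addFirstRow m (rows p) := by
    intro p
    obtain ⟨b, L, hp⟩ := hcons hN0 p
    have h1 := rows_sortedGE p
    have h2 := mem_rows_pos p
    have h3 := rows_sum p
    rw [hp] at h1 h2 h3 ⊢
    refine exists_rows_eq ?_ ?_ ?_
    · have h4 := List.pairwise_cons.mp h1.pairwise
      refine (List.pairwise_cons.mpr ⟨fun c hc => ?_, h4.2⟩).sortedGE
      exact (h4.1 c hc).le.trans (Nat.le_add_right _ _)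
    · intro c hc
      rcases List.mem_cons.mp hc with rfl | hc
      · exact lt_of_lt_of_le (h2 b List.mem_cons_self) (Nat.le_add_right _ _)
      · exact h2 c (List.mem_cons_of_mem _ hc)
    · rw [addFirstRow]
      rw [List.sum_cons] at h3 ⊢
      omega
  choose φ hφ using hφ
  symm
  refine Finset.sum_of_injOn φ ?_ (fun _ _ => mem_coe.mpr (mem_univ _)) ?_ ?_
  · intro p _ p' _ hpp
    have h1 : addFirstRow m (rows p) = addFirstRow m (rows p') := by rw [← hφ, ← hφ, hpp]
    obtain ⟨b, L, hp⟩ := hcons hN0 p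
    obtain ⟨b', L', hp'⟩ := hcons hN0 p'
    rw [hp, hp'] at h1
    simp only [addFirstRow, List.cons.injEq, add_left_inj] at h1
    refine rows_injective ?_
    rw [hp, hp', h1.1, h1.2]
  · intro q _ hq
    obtain ⟨b, L, hqL⟩ := hcons (by omega) q
    have h1 := rows_sortedGE q
    have h2 := mem_rows_pos q
    have h3 := rows_sum q
    rw [hqL] at h1 h2 h3
    rw [hqL, inducedMult_eq_zero a (by omega) h1 h3, zero_mul]
    by_contra hlt
    apply hq
    have h4 := List.pairwise_cons.mp h1.pairwise
    rw [List.sum_cons] at h3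
    obtain ⟨p, hp⟩ := exists_rows_eq (n := N) (L := (b - m) :: L)
      (by
        refine (List.pairwise_cons.mpr ⟨fun c hc => ?_, h4.2⟩).sortedGE
        have := List.le_sum_of_mem hc
        omega)
      (by
        intro c hc
        rcases List.mem_cons.mp hc with rfl | hc
        · omega
        · exact h2 c (List.mem_cons_of_mem _ hc))
      (by
        rw [List.sum_cons]
        omega)
    refine ⟨p, mem_coe.mpr (mem_univ _), rows_injective ?_⟩
    rw [hφ, hp, hqL, addFirstRow]
    congr 1
    omega
  · intro p _
    obtain ⟨b, L, hp⟩ := hcons hN0 p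
    have h1 := rows_sortedGE p
    have h3 := rows_sum p
    change inducedMult R a N (rows p) * _ = _
    rw [hφ p]
    rw [hp] at h1 h3 ⊢
    rw [addFirstRow, inducedMult_addFirstRow a hN h1 h3]

end Stability

section Sharpness

/-- If a sequence stabilizes before `2 c`, then the irreducible character with two rows of length
`c` does not occur in its member at `2 c`. -/
theorem StabilizesBeyond.pairing_two_rows_eq_zero {χ : ∀ n : ℕ, Equiv.Perm (Fin n) → ℤ} {k c : ℕ}
    (h : StabilizesBeyond χ k) (hkc : k < 2 * c) :
    pairing (χ (2 * c)) (irrChar [c, c]) = 0 := by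
  obtain ⟨a, -, ha⟩ := h
  obtain ⟨m, hm⟩ : ∃ m, 2 * c = k + m := ⟨2 * c - k, by omega⟩
  rw [hm]
  have h1 : χ (k + m) = fun w => ∑ p, a p * irrChar (addFirstRow m (rows p)) w :=
    funext (ha m)
  rw [h1, pairing_sum_left]
  refine Finset.sum_eq_zero fun p _ => ?_
  have h1 := rows_sortedGE p
  have h2 := mem_rows_pos p
  have h3 := rows_sum p
  have hcc : ([c, c] : List ℕ).SortedGE := by
    refine List.Pairwise.sortedGE ?_
    simp
  have hcc' : ∀ b ∈ [c, c], 0 < b := by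
    intro b hb
    have : b = c := by simpa using hb
    omega
  have key : ∀ L : List ℕ, L.SortedGE → (∀ b ∈ L, 0 < b) → L.sum = k + m → L ≠ [c, c] →
      pairing (n := k + m) (irrChar L) (irrChar [c, c]) = 0 := by
    intro L hL hL' hs hne
    rw [pairing_irrChar hL hcc hL' hcc' hs (by simp; omega), if_neg hne]
  rcases hp : rows p with _ | ⟨b, L⟩
  · rw [hp, List.sum_nil] at h3
    rw [addFirstRow, key [m] (List.pairwise_singleton _ _).sortedGE (by simp; omega) (by simp; omega)
      (by simp), mul_zero]
  · rw [hp] at h1 h2 h3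
    have h4 := List.pairwise_cons.mp h1.pairwise
    rw [addFirstRow, key ((b + m) :: L), mul_zero]
    · refine (List.pairwise_cons.mpr ⟨fun c hc => ?_, h4.2⟩).sortedGE
      exact (h4.1 c hc).le.trans (Nat.le_add_right _ _)
    · intro c hc
      rcases List.mem_cons.mp hc with rfl | hc
      · exact lt_of_lt_of_le (h2 b List.mem_cons_self) (Nat.le_add_right _ _)
      · exact h2 c (List.mem_cons_of_mem _ hc)
    · rw [List.sum_cons] at h3 ⊢
      omega
    · intro hL
      rw [List.cons.injEq] at hL
      have h5 : c ≤ b := (h4.1 c (by rw [hL.2]; simp)).le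
      omega

theorem altCoeff_two_rows (c : ℕ) (P : MvPolynomial (Fin 2) ℤ) :
    altCoeff (fun _ : Fin 2 => (c : ℤ)) (completeHom X (c : ℤ) * P) =
      coeffZ P ![0, (c : ℤ)] := by
  have hβ : ∀ β : Fin 2 →₀ ℕ,
      altCoeff (fun _ : Fin 2 => (c : ℤ)) (completeHom X (c : ℤ) * monomial β 1) =
        if Finsupp.equivFunOnFinite.symm ![0, c] = β then 1 else 0 := by
    intro β
    rw [altCoeff_completeHom_mul_monomial (q := 1) _ (fun _ => by positivity)]
    have key : ∀ σ : Equiv.Perm (Fin 2), (∀ k : Fin 2, (c : ℤ) - (k : ℕ) =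
        (if σ k = 0 then (c : ℤ) else 0) - (σ k : ℕ) + β k) → σ = 1 := by
      intro σ h
      have h0 := (fixes_zero_of_shape (q := 1) (Λ := fun _ => (c : ℤ)) (fun _ => by positivity)
        antitone_const (le_refl c) (by simp; ring) h).1
      have h1 : σ 1 ≠ 0 := fun h1 => by
        have := σ.injective (h1.trans h0.symm)
        simp at this
      ext k
      fin_cases k
      · simp [h0]
      · have : σ 1 = 1 := by omega
        simp [this]
    rw [Finset.sum_eq_single 1]
    · simp only [Equiv.Perm.sign_one, Units.val_one, one_mul, Equiv.Perm.one_apply]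
      refine if_congr ?_ rfl rfl
      rw [DFunLike.ext_iff, Fin.forall_fin_two, Fin.forall_fin_two]
      simp
      omega
    · intro σ _ hσ
      rw [if_neg fun h => hσ (key σ h), mul_zero]
    · simp
  rw [altCoeff_mul_eq_sum]
  simp only [hβ, mul_ite, mul_one, mul_zero]
  have hc : ∀ j : Fin 2, 0 ≤ (![0, (c : ℤ)] : Fin 2 → ℤ) j := by
    rw [Fin.forall_fin_two]
    simp
  have hc' : (fun j : Fin 2 => ((![0, (c : ℤ)] : Fin 2 → ℤ) j).toNat) = ![0, c] := by
    funext j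
    fin_cases j <;> simp
  rw [Finset.sum_ite_eq, coeffZ, if_pos hc, hc']
  split_ifs with h
  · rfl
  · exact (notMem_support_iff.mp h).symm

theorem youngChar_zero_full {n : ℕ} (w : Equiv.Perm (Fin n)) :
    youngChar ![0, (n : ℤ)] w = 1 := by
  rw [youngChar, Nat.cast_eq_one, Finset.card_eq_one]
  refine ⟨fun _ => 1, ?_⟩
  ext e
  rw [Finset.mem_filter, Finset.mem_singleton]
  constructor
  · rintro ⟨-, -, h⟩
    have h0 := h 0
    simp only [Matrix.cons_val_zero, Nat.cast_eq_zero, Finset.card_eq_zero] at h0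
    funext x
    have : e x ≠ 0 := fun hx => by
      have : x ∈ (univ.filter fun x => e x = 0) := by simp [hx]
      rw [h0] at this
      simp at this
    exact Fin.eq_one_of_ne_zero _ this
  · rintro rfl
    refine ⟨mem_univ _, fun _ => rfl, ?_⟩
    rw [Fin.forall_fin_two]
    simp

/-- The multiplicity of the irreducible character with two rows of length `c` in
`∑_{r ≤ c} h_{2c-r} f_r` is the multiplicity of the trivial character in `f_c`. -/
theorem factorial_mul_inducedMult_two_rows (a : ∀ r : ℕ, r.Partition → ℤ) (c : ℕ)
    (f : Equiv.Perm (Fin c) → ℤ) (hf : ∀ w, f w = ∑ p, a c p * irrChar (rows p) w) :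
    c.factorial * inducedMult c a (2 * c) [c, c] = ∑ w, f w := by
  have h1 : HasFrobenius (l := 2) f
      (∑ p : c.Partition, a c p • jacobiTrudi X fun i => ((rows p).get i : ℤ)) := by
    rw [show f = fun w => ∑ p, a c p * irrChar (rows p) w from funext hf]
    refine HasFrobenius.sum _ fun p _ => ?_
    exact hasFrobenius_schurChar _ (by rw [sum_get_cast, rows_sum])
  have h2 : (fun i : Fin 2 => (([c, c] : List ℕ).get i : ℤ)) = fun _ => (c : ℤ) := by
    funext i
    fin_cases i <;> rfl
  have h3 : inducedMult c a (2 * c) [c, c] = altCoeff (fun _ : Fin 2 => (c : ℤ))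
      (completeHom X (c : ℤ) *
        ∑ p : c.Partition, a c p • jacobiTrudi X fun i => ((rows p).get i : ℤ)) := by
    rw [inducedMult, Finset.sum_range_succ, Finset.sum_eq_zero, zero_add, Finset.mul_sum,
      altCoeff_sum]
    · refine Finset.sum_congr rfl fun p _ => ?_
      rw [mul_smul_comm, altCoeff_smul]
      have : ((2 * c : ℕ) : ℤ) - (c : ℤ) = c := by push_cast; ring
      rw [this]
      exact congrArg (fun Λ : Fin 2 → ℤ => a c p * altCoeff Λ (completeHom X (c : ℤ) *
        jacobiTrudi X fun i => ((rows p).get i : ℤ))) h2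
    · intro r hr
      rw [Finset.mem_range] at hr
      refine Finset.sum_eq_zero fun p _ => ?_
      have key := altCoeff_eq_zero (q := 1) (Λ := fun _ => (c : ℤ)) (fun _ => by positivity)
        antitone_const (a := 2 * c - r) (r := r) (by omega) (by simp; omega) (by omega)
        (jacobiTrudi X fun i => ((rows p).get i : ℤ))
      have e : (((2 * c - r : ℕ) : ℕ) : ℤ) = ((2 * c : ℕ) : ℤ) - r := by omega
      rw [e, ← h2] at key
      refine (congrArg (a r p * ·) key).trans (mul_zero _)
  rw [h3, altCoeff_two_rows, ← h1, pairing]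
  exact Finset.sum_congr rfl fun w _ => by rw [youngChar_zero_full, mul_one]

end Sharpness

section Rank

variable {V : Type*} [Finite V]

instance finite_setoid : Finite (Setoid V) :=
  Finite.of_injective (fun p : Setoid V => fun x y => p x y) fun _ _ h =>
    Setoid.ext fun x y => iff_of_eq (congrFun (congrFun h x) y)

/-- The rank of a set partition: the number of points minus the number of blocks. -/
noncomputable def setoidRank (p : Setoid V) : ℕ := Nat.card V - Nat.card (Quotient p)

theorem card_quotient_le (p : Setoid V) : Nat.card (Quotient p) ≤ Nat.card V :=
  Nat.card_le_card_of_surjective _ Quotient.mk_surjective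

theorem card_quotient_lt_of_lt {p q : Setoid V} (h : p < q) :
    Nat.card (Quotient q) < Nat.card (Quotient p) := by
  have hsurj : Function.Surjective (Quotient.map' id fun _ _ h' => h.le h' :
      Quotient p → Quotient q) := by
    rintro ⟨x⟩
    exact ⟨Quotient.mk p x, rfl⟩
  refine lt_of_le_of_ne (Nat.card_le_card_of_surjective _ hsurj) fun heq => ?_
  have hbij := (Nat.bijective_iff_surjective_and_card _).mpr ⟨hsurj, heq.symm⟩
  refine h.not_ge fun x y hxy => ?_
  exact Quotient.exact (hbij.injective (a₁ := Quotient.mk p x) (a₂ := Quotient.mk p y)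
    (Quotient.sound hxy))

theorem setoidRank_strictMono : StrictMono (setoidRank : Setoid V → ℕ) := by
  intro p q h
  have h1 := card_quotient_lt_of_lt h
  have h2 := card_quotient_le p
  rw [setoidRank, setoidRank]
  omega

/-- The set partition obtained by merging the blocks of `a` and `b`. -/
def mergeBlocks (p : Setoid V) (a b : V) : Setoid V where
  r x y := p x y ∨ ((p x a ∨ p x b) ∧ (p y a ∨ p y b))
  iseqv := by
    refine ⟨fun x => Or.inl (p.refl x), ?_, ?_⟩
    · rintro x y (h | ⟨h1, h2⟩)
      · exact Or.inl (p.symm h)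
      · exact Or.inr ⟨h2, h1⟩
    · rintro x y z (h | ⟨h1, h2⟩) (h' | ⟨h1', h2'⟩)
      · exact Or.inl (p.trans h h')
      · exact Or.inr ⟨h1'.imp (p.trans h) (p.trans h), h2'⟩
      · exact Or.inr ⟨h1, h2.imp (p.trans (p.symm h')) (p.trans (p.symm h'))⟩
      · exact Or.inr ⟨h1, h2'⟩

omit [Finite V] in
theorem mergeBlocks_def {p : Setoid V} {a b x y : V} :
    mergeBlocks p a b x y ↔ p x y ∨ ((p x a ∨ p x b) ∧ (p y a ∨ p y b)) := Iff.rfl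

theorem card_quotient_mergeBlocks (p : Setoid V) (a b : V) :
    Nat.card (Quotient p) ≤ Nat.card (Quotient (mergeBlocks p a b)) + 1 := by
  have hinj : Function.Injective fun c : {c : Quotient p // c ≠ Quotient.mk p b} =>
      (Quotient.map' id (fun _ _ h => Or.inl h) c.1 : Quotient (mergeBlocks p a b)) := by
    rintro ⟨⟨x⟩, hx⟩ ⟨⟨y⟩, hy⟩ h
    have h1 : mergeBlocks p a b x y := Quotient.exact h
    have hx' : ¬ p x b := fun h => hx (Quotient.sound h)
    have hy' : ¬ p y b := fun h => hy (Quotient.sound h)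
    refine Subtype.ext (Quotient.sound ?_)
    rcases h1 with h1 | ⟨h1 | h1, h2 | h2⟩
    · exact h1
    · exact p.trans h1 (p.symm h2)
    · exact absurd h2 hy'
    · exact absurd h1 hx'
    · exact absurd h1 hx'
  have h1 := Nat.card_le_card_of_injective _ hinj
  have h2 : Nat.card {c : Quotient p // c ≠ Quotient.mk p b} = Nat.card (Quotient p) - 1 := by
    have := Set.ncard_compl {Quotient.mk p b}
    rw [Set.ncard_singleton] at this
    rw [← this]
    rfl
  omega

theorem exists_setoidRank_succ {p q : Setoid V} (h : p < q) :
    ∃ z, p ≤ z ∧ z ≤ q ∧ setoidRank z = setoidRank p + 1 := by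
  obtain ⟨a, b, hq, hp⟩ : ∃ a b, q a b ∧ ¬ p a b := by
    by_contra hcon
    push Not at hcon
    exact h.not_ge fun x y hxy => hcon x y hxy
  have hle : p ≤ mergeBlocks p a b := fun x y hxy => Or.inl hxy
  have hlt : p < mergeBlocks p a b :=
    lt_of_le_not_ge hle fun h' =>
      hp (h' (mergeBlocks_def.mpr (Or.inr ⟨Or.inl (p.refl a), Or.inr (p.refl b)⟩)))
  refine ⟨mergeBlocks p a b, hle, ?_, ?_⟩
  · have hclass : ∀ z, p z a ∨ p z b → q z a := by
      rintro z (hz | hz)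
      · exact h.le hz
      · exact q.trans (h.le hz) (q.symm hq)
    rintro x y (hxy | ⟨h1, h2⟩)
    · exact h.le hxy
    · exact q.trans (hclass x h1) (q.symm (hclass y h2))
  · have h1 := card_quotient_lt_of_lt hlt
    have h2 := card_quotient_mergeBlocks p a b
    have h3 := card_quotient_le p
    rw [setoidRank, setoidRank]
    omega

theorem exists_setoidRank_eq {p q : Setoid V} (h : p ≤ q) {t : ℕ} (hp : setoidRank p ≤ t)
    (hq : t ≤ setoidRank q) : ∃ z, p ≤ z ∧ z ≤ q ∧ setoidRank z = t := by
  induction t, hp using Nat.le_induction with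
  | base => exact ⟨p, le_rfl, h, rfl⟩
  | succ t _ ih =>
    obtain ⟨z, hpz, hzq, hz⟩ := ih (by omega)
    have hlt : z < q := lt_of_le_of_ne hzq fun h => by
      rw [← h] at hq
      omega
    obtain ⟨z', h1, h2, h3⟩ := exists_setoidRank_succ hlt
    exact ⟨z', hpz.trans h1, h2, by omega⟩

theorem setoidRank_bot : setoidRank (⊥ : Setoid V) = 0 := by
  have hinj : Function.Injective (Quotient.mk (⊥ : Setoid V)) := fun _ _ h => Quotient.exact h
  have := Nat.card_le_card_of_injective _ hinj
  rw [setoidRank]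
  omega

theorem setoidRank_top : setoidRank (⊤ : Setoid V) = Nat.card V - 1 := by
  have hsub : Subsingleton (Quotient (⊤ : Setoid V)) := by
    refine ⟨?_⟩
    rintro ⟨x⟩ ⟨y⟩
    exact Quotient.sound trivial
  have h1 : Nat.card (Quotient (⊤ : Setoid V)) ≤ 1 := Finite.card_le_one_iff_subsingleton.mpr hsub
  rcases isEmpty_or_nonempty V with hV | ⟨⟨v⟩⟩
  · rw [setoidRank, Nat.card_of_isEmpty]
    simp
  · have : Nonempty (Quotient (⊤ : Setoid V)) := ⟨Quotient.mk _ v⟩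
    have := Nat.card_pos (α := Quotient (⊤ : Setoid V))
    rw [setoidRank]
    omega

/-- The height of a set partition is its number of points minus its number of blocks. -/
theorem height_eq_setoidRank (p : Setoid V) : Order.height p = setoidRank p := by
  rw [Order.height_eq_of_strictMono _ setoidRank_strictMono, Order.height_nat]
  intro q b hb
  obtain ⟨z, -, hz, hzb⟩ := exists_setoidRank_eq (bot_le : ⊥ ≤ q)
    (by rw [setoidRank_bot]; exact Nat.zero_le b) hb.le
  exact ⟨z, lt_of_le_of_ne hz fun h => by rw [h] at hzb; omega, hzb⟩

theorem mem_rankSelected {T : Finset ℕ} {p : Setoid V} :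
    p ∈ rankSelected (Setoid V) T ↔ setoidRank p ∈ T := by
  simp only [rankSelected, Set.mem_ofPred_eq, height_eq_setoidRank, Nat.cast_inj]
  exact ⟨fun ⟨s, hs, h⟩ => h ▸ hs, fun h => ⟨_, h, rfl⟩⟩

/-- The chains of set partitions whose set of ranks is `T`. -/
def chainsOfRank (V : Type*) [Finite V] (T : Finset ℕ) : Set (Set (Setoid V)) :=
  {C | (∀ p ∈ C, setoidRank p ∈ T) ∧ IsChain (· ≤ ·) C ∧ ∀ t ∈ T, ∃ p ∈ C, setoidRank p = t}

theorem IsChain.le_of_setoidRank_le {C : Set (Setoid V)} (hC : IsChain (· ≤ ·) C) {p q : Setoid V}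
    (hp : p ∈ C) (hq : q ∈ C) (h : setoidRank p ≤ setoidRank q) : p ≤ q := by
  rcases hC.total hp hq with h' | h'
  · exact h'
  · rcases h'.eq_or_lt with rfl | h'
    · exact le_rfl
    · have := setoidRank_strictMono h'
      omega

/-- If all the ranks in `T` occur, the maximal chains of the rank-selected subposet are the
chains that meet all these ranks. -/
theorem maxChains_eq_chainsOfRank {T : Finset ℕ} (hT : ∀ t ∈ T, t < Nat.card V) :
    maxChains (Setoid V) T = chainsOfRank V T := by
  ext C
  constructor
  · rintro ⟨⟨hCT, hC⟩, hmax⟩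
    refine ⟨fun p hp => mem_rankSelected.mp (hCT hp), hC, fun t ht => ?_⟩
    by_contra hcon
    push Not at hcon
    obtain ⟨a, hat, haL, haU⟩ : ∃ a : Setoid V, setoidRank a ≤ t ∧
        (∀ p ∈ C, setoidRank p < t → p ≤ a) ∧ ∀ p ∈ C, t < setoidRank p → a ≤ p := by
      rcases Set.eq_empty_or_nonempty {p ∈ C | setoidRank p < t} with hL | hL
      · refine ⟨⊥, by rw [setoidRank_bot]; exact Nat.zero_le _, fun p hp hpt => ?_,
          fun p _ _ => bot_le⟩
        have : p ∈ {p ∈ C | setoidRank p < t} := ⟨hp, hpt⟩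
        rw [hL] at this
        exact this.elim
      · obtain ⟨a, ha, hamax⟩ := Set.exists_max_image _ setoidRank (Set.toFinite _) hL
        refine ⟨a, ha.2.le, fun p hp hpt => ?_, fun p hp hpt => ?_⟩
        · exact IsChain.le_of_setoidRank_le hC hp ha.1 (hamax p ⟨hp, hpt⟩)
        · exact IsChain.le_of_setoidRank_le hC ha.1 hp (ha.2.trans hpt).le
    obtain ⟨b, hbt, hbU, hab⟩ : ∃ b : Setoid V, t ≤ setoidRank b ∧
        (∀ p ∈ C, t < setoidRank p → b ≤ p) ∧ a ≤ b := by
      rcases Set.eq_empty_or_nonempty {p ∈ C | t < setoidRank p} with hU | hU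
      · refine ⟨⊤, ?_, fun p hp hpt => ?_, le_top⟩
        · have := hT t ht
          rw [setoidRank_top]
          omega
        · have : p ∈ {p ∈ C | t < setoidRank p} := ⟨hp, hpt⟩
          rw [hU] at this
          exact this.elim
      · obtain ⟨b, hb, hbmin⟩ := Set.exists_min_image _ setoidRank (Set.toFinite _) hU
        exact ⟨b, hb.2.le, fun p hp hpt =>
          IsChain.le_of_setoidRank_le hC hb.1 hp (hbmin p ⟨hp, hpt⟩), haU b hb.1 hb.2⟩
    obtain ⟨z, haz, hzb, hz⟩ := exists_setoidRank_eq hab hat hbt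
    have hins : insert z C ⊆ rankSelected (Setoid V) T ∧ IsChain (· ≤ ·) (insert z C) := by
      refine ⟨Set.insert_subset (mem_rankSelected.mpr (hz ▸ ht)) hCT, hC.insert fun p hp _ => ?_⟩
      rcases lt_trichotomy (setoidRank p) t with h | h | h
      · exact Or.inr ((haL p hp h).trans haz)
      · exact absurd h (hcon p hp)
      · exact Or.inl (hzb.trans (hbU p hp h))
    exact hcon z (hmax hins (Set.subset_insert z C) (Set.mem_insert z C)) hz
  · rintro ⟨hCT, hC, hall⟩
    refine ⟨⟨fun p hp => mem_rankSelected.mpr (hCT p hp), hC⟩, ?_⟩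
    rintro D ⟨hDT, hD⟩ hCD d hd
    obtain ⟨p, hp, hpd⟩ := hall _ (mem_rankSelected.mp (hDT hd))
    have h1 := IsChain.le_of_setoidRank_le hD (hCD hp) hd hpd.le
    have h2 := IsChain.le_of_setoidRank_le hD hd (hCD hp) hpd.ge
    rwa [← le_antisymm h1 h2]

end Rank

section Support

variable {V : Type*}

/-- The points of a set partition that lie in blocks with at least two elements. -/
def support (p : Setoid V) : Set V := {x | ∃ y, y ≠ x ∧ p x y}

theorem support_mono {p q : Setoid V} (h : p ≤ q) : support p ⊆ support q := by
  rintro x ⟨y, hy, hxy⟩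
  exact ⟨y, hy, h hxy⟩

theorem ncard_support_le [Finite V] (p : Setoid V) : (support p).ncard ≤ 2 * setoidRank p := by
  set o : V → V := fun x => Quotient.out (Quotient.mk p x) with ho
  have hop : ∀ x, p (o x) x := fun x => Quotient.exact (Quotient.out_eq (Quotient.mk p x))
  have hoeq : ∀ x y, p x y → o x = o y := fun x y h => by
    simp only [ho]
    rw [Quotient.sound h]
  set N : Set V := {x | o x ≠ x} with hN
  have h1 : support p ⊆ N ∪ o '' N := by
    rintro x ⟨y, hy, hxy⟩
    by_cases hx : o x = x
    · refine Or.inr ⟨y, ?_, (hoeq x y hxy).symm.trans hx⟩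
      intro hoy
      exact hy (hoy.symm.trans ((hoeq x y hxy).symm.trans hx))
    · exact Or.inl hx
  have h2 : N.ncard = setoidRank p := by
    have h3 : Nᶜ = Set.range (Quotient.out : Quotient p → V) := by
      ext x
      rw [hN, Set.mem_compl_iff, Set.mem_ofPred_eq, not_not]
      constructor
      · intro h
        exact ⟨_, h⟩
      · rintro ⟨c, rfl⟩
        simp only [ho]
        rw [Quotient.out_eq]
    have h4 := Set.ncard_add_ncard_compl N
    rw [h3, ← Set.image_univ, Set.ncard_image_of_injective _ Quotient.out_injective,
      Set.ncard_univ] at h4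
    rw [setoidRank]
    omega
  calc (support p).ncard ≤ (N ∪ o '' N).ncard := Set.ncard_le_ncard h1
    _ ≤ N.ncard + (o '' N).ncard := Set.ncard_union_le _ _
    _ ≤ N.ncard + N.ncard := by
      have := Set.ncard_image_le (s := N) (f := o)
      omega
    _ = 2 * setoidRank p := by omega

/-- The union of the supports of the members of a family of set partitions. -/
def chainSupport (C : Set (Setoid V)) : Set V := ⋃ p ∈ C, support p

theorem ncard_chainSupport_le [Finite V] {C : Set (Setoid V)} (hC : IsChain (· ≤ ·) C) {R : ℕ}
    (hR : ∀ p ∈ C, setoidRank p ≤ R) : (chainSupport C).ncard ≤ 2 * R := by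
  rcases Set.eq_empty_or_nonempty C with rfl | hne
  · simp [chainSupport]
  · obtain ⟨a, ha, hamax⟩ := Set.exists_max_image C setoidRank (Set.toFinite _) hne
    have h1 : chainSupport C ⊆ support a := by
      refine Set.iUnion₂_subset fun p hp => support_mono ?_
      exact IsChain.le_of_setoidRank_le hC hp ha (hamax p hp)
    have h2 := Set.ncard_le_ncard h1
    have h3 := ncard_support_le a
    have h4 := hR a ha
    omega

end Support

section Extension

variable {U V : Type*}

/-- The extension of a set partition along an injective map, with singletons outside the range. -/
def extendSetoid (ι : U → V) (hι : Function.Injective ι) (q : Setoid U) : Setoid V where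
  r x y := x = y ∨ ∃ a b, ι a = x ∧ ι b = y ∧ q a b
  iseqv := by
    refine ⟨fun x => Or.inl rfl, ?_, ?_⟩
    · rintro x y (rfl | ⟨a, b, ha, hb, h⟩)
      · exact Or.inl rfl
      · exact Or.inr ⟨b, a, hb, ha, q.symm h⟩
    · rintro x y z (rfl | ⟨a, b, ha, hb, h⟩) (rfl | ⟨a', b', ha', hb', h'⟩)
      · exact Or.inl rfl
      · exact Or.inr ⟨a', b', ha', hb', h'⟩
      · exact Or.inr ⟨a, b, ha, hb, h⟩
      · obtain rfl := hι (hb.trans ha'.symm)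
        exact Or.inr ⟨a, b', ha, hb', q.trans h h'⟩

variable {ι : U → V} {hι : Function.Injective ι}

theorem extendSetoid_def {q : Setoid U} {x y : V} :
    extendSetoid ι hι q x y ↔ x = y ∨ ∃ a b, ι a = x ∧ ι b = y ∧ q a b := Iff.rfl

theorem extendSetoid_apply {q : Setoid U} {a b : U} :
    extendSetoid ι hι q (ι a) (ι b) ↔ q a b := by
  rw [extendSetoid_def]
  constructor
  · rintro (h | ⟨a', b', ha, hb, h⟩)
    · rw [hι h]
    · rwa [← hι ha, ← hι hb]
  · exact fun h => Or.inr ⟨a, b, rfl, rfl, h⟩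

theorem extendSetoid_le_iff {q q' : Setoid U} :
    extendSetoid ι hι q ≤ extendSetoid ι hι q' ↔ q ≤ q' := by
  constructor
  · intro h a b hab
    exact extendSetoid_apply.mp (h (extendSetoid_apply.mpr hab))
  · rintro h x y (hxy | ⟨a, b, ha, hb, hab⟩)
    · exact Or.inl hxy
    · exact Or.inr ⟨a, b, ha, hb, h hab⟩

theorem extendSetoid_injective : Function.Injective (extendSetoid ι hι) := fun _ _ h =>
  le_antisymm (extendSetoid_le_iff.mp h.le) (extendSetoid_le_iff.mp h.ge)

theorem extendSetoid_comap {p : Setoid V} (hp : support p ⊆ Set.range ι) :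
    extendSetoid ι hι (Setoid.comap ι p) = p := by
  ext x y
  rw [extendSetoid_def]
  constructor
  · rintro (rfl | ⟨a, b, rfl, rfl, h⟩)
    · exact p.refl x
    · exact h
  · intro h
    by_cases hxy : x = y
    · exact Or.inl hxy
    · obtain ⟨a, rfl⟩ := hp ⟨y, Ne.symm hxy, h⟩
      obtain ⟨b, rfl⟩ := hp ⟨ι a, hxy, p.symm h⟩
      exact Or.inr ⟨a, b, rfl, rfl, h⟩

theorem support_extendSetoid (q : Setoid U) :
    support (extendSetoid ι hι q) = ι '' support q := by
  ext x
  constructor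
  · rintro ⟨y, hy, rfl | ⟨a, b, rfl, rfl, h⟩⟩
    · exact absurd rfl hy
    · exact ⟨a, ⟨b, fun h => hy (congrArg ι h), h⟩, rfl⟩
  · rintro ⟨a, ⟨b, hb, h⟩, rfl⟩
    exact ⟨ι b, fun h => hb (hι h), extendSetoid_apply.mpr h⟩

theorem support_extendSetoid_subset (q : Setoid U) :
    support (extendSetoid ι hι q) ⊆ Set.range ι := by
  rw [support_extendSetoid]
  exact Set.image_subset_range _ _

theorem setoidRank_extendSetoid [Finite U] [Finite V] (q : Setoid U) :
    setoidRank (extendSetoid ι hι q) = setoidRank q := by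
  have hmono : StrictMono (extendSetoid ι hι) := fun _ _ h =>
    lt_of_le_not_ge (extendSetoid_le_iff.mpr h.le) fun h' => h.not_ge (extendSetoid_le_iff.mp h')
  have h := Order.height_eq_of_strictMono _ hmono (fun a b hb => by
    have hb' := extendSetoid_comap (hι := hι)
      ((support_mono hb.le).trans (support_extendSetoid_subset a))
    refine ⟨_, ?_, hb'⟩
    rw [← hb'] at hb
    exact lt_of_le_not_ge (extendSetoid_le_iff.mp hb.le)
      fun h' => hb.not_ge (extendSetoid_le_iff.mpr h')) q
  rw [height_eq_setoidRank, height_eq_setoidRank] at h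
  exact_mod_cast h.symm

theorem chainSupport_image_extendSetoid (C : Set (Setoid U)) :
    chainSupport (extendSetoid ι hι '' C) = ι '' chainSupport C := by
  simp only [chainSupport, Set.biUnion_image, support_extendSetoid, Set.image_iUnion₂]

theorem image_extendSetoid_mem_chainsOfRank [Finite U] [Finite V] {T : Finset ℕ}
    {C : Set (Setoid U)} :
    extendSetoid ι hι '' C ∈ chainsOfRank V T ↔ C ∈ chainsOfRank U T := by
  have h1 : IsChain (· ≤ ·) (extendSetoid ι hι '' C) ↔ IsChain (· ≤ ·) C := by
    constructor
    · intro h p hp q hq hpq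
      have := h (Set.mem_image_of_mem _ hp) (Set.mem_image_of_mem _ hq)
        (extendSetoid_injective.ne hpq)
      simpa only [extendSetoid_le_iff] using this
    · rintro h _ ⟨p, hp, rfl⟩ _ ⟨q, hq, rfl⟩ hpq
      have := h hp hq fun h => hpq (congrArg _ h)
      simpa only [extendSetoid_le_iff] using this
  unfold chainsOfRank
  simp only [Set.mem_ofPred_eq, Set.forall_mem_image, Set.exists_mem_image,
    setoidRank_extendSetoid, h1]

theorem exists_image_extendSetoid_eq {C : Set (Setoid V)} (hC : chainSupport C ⊆ Set.range ι) :
    ∃ D : Set (Setoid U), extendSetoid ι hι '' D = C := by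
  refine ⟨extendSetoid ι hι ⁻¹' C, Set.image_preimage_eq_of_subset fun p hp => ?_⟩
  exact ⟨_, extendSetoid_comap ((Set.subset_biUnion_of_mem hp).trans hC)⟩

end Extension

section Permute

variable {n : ℕ}

theorem permute_apply (w : Equiv.Perm (Fin n)) (p : Setoid (Fin n)) (x y : Fin n) :
    permute w p x y ↔ p (w⁻¹ x) (w⁻¹ y) := Iff.rfl

theorem permute_mul (u v : Equiv.Perm (Fin n)) (p : Setoid (Fin n)) :
    permute (u * v) p = permute u (permute v p) := by
  ext x y
  simp only [permute_apply, mul_inv_rev, Equiv.Perm.mul_apply]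
  rfl

theorem permute_one (p : Setoid (Fin n)) : permute 1 p = p := by
  ext x y
  simp only [permute_apply, inv_one, Equiv.Perm.one_apply]

theorem permute_eq_extendSetoid (w : Equiv.Perm (Fin n)) (p : Setoid (Fin n)) :
    permute w p = extendSetoid w w.injective p := by
  ext x y
  rw [permute_apply, extendSetoid_def]
  constructor
  · intro h
    exact Or.inr ⟨_, _, by simp, by simp, h⟩
  · rintro (rfl | ⟨a, b, rfl, rfl, h⟩)
    · exact p.refl _
    · simpa using h

theorem image_permute_eq (w : Equiv.Perm (Fin n)) (C : Set (Setoid (Fin n))) :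
    permute w '' C = extendSetoid w w.injective '' C :=
  Set.image_congr fun p _ => permute_eq_extendSetoid w p

theorem image_permute_mul (u v : Equiv.Perm (Fin n)) (C : Set (Setoid (Fin n))) :
    permute (u * v) '' C = permute u '' (permute v '' C) := by
  rw [Set.image_image]
  exact Set.image_congr fun p _ => permute_mul u v p

theorem image_permute_one (C : Set (Setoid (Fin n))) : permute 1 '' C = C := by
  rw [Set.image_congr fun p _ => permute_one p, Set.image_id']

theorem image_permute_mem_chainsOfRank (w : Equiv.Perm (Fin n)) {T : Finset ℕ}
    {C : Set (Setoid (Fin n))} :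
    permute w '' C ∈ chainsOfRank (Fin n) T ↔ C ∈ chainsOfRank (Fin n) T := by
  rw [image_permute_eq, image_extendSetoid_mem_chainsOfRank]

theorem chainSupport_image_permute (w : Equiv.Perm (Fin n)) (C : Set (Setoid (Fin n))) :
    chainSupport (permute w '' C) = w '' chainSupport C := by
  rw [image_permute_eq, chainSupport_image_extendSetoid]

theorem permute_extendSetoid {r : ℕ} {ι : Fin r → Fin n} {hι : Function.Injective ι}
    {w : Equiv.Perm (Fin n)} {u : Equiv.Perm (Fin r)} (hwu : ∀ a, w (ι a) = ι (u a))
    (q : Setoid (Fin r)) :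
    permute w (extendSetoid ι hι q) = extendSetoid ι hι (permute u q) := by
  have hinv : ∀ a, w⁻¹ (ι a) = ι (u⁻¹ a) := by
    intro a
    rw [Equiv.Perm.inv_eq_iff_eq, hwu]
    simp
  ext x y
  rw [permute_apply, extendSetoid_def, extendSetoid_def, (w⁻¹).injective.eq_iff]
  refine or_congr Iff.rfl ⟨?_, ?_⟩
  · rintro ⟨a, b, ha, hb, h⟩
    refine ⟨u a, u b, ?_, ?_, ?_⟩
    · rw [← hwu, ha]
      simp
    · rw [← hwu, hb]
      simp
    · rw [permute_apply]
      simpa using h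
  · rintro ⟨a, b, rfl, rfl, h⟩
    exact ⟨u⁻¹ a, u⁻¹ b, (hinv a).symm, (hinv b).symm, h⟩

/-- The number of chains of set partitions with rank set `T` and given support that are fixed
by `w`. -/
noncomputable def fixedChains (T : Finset ℕ) (A : Set (Fin n)) (w : Equiv.Perm (Fin n)) : ℤ :=
  ({C | C ∈ chainsOfRank (Fin n) T ∧ chainSupport C = A ∧ permute w '' C = C}.ncard : ℤ)

theorem fixedChains_range {r : ℕ} {ι : Fin r → Fin n} (hι : Function.Injective ι)
    {w : Equiv.Perm (Fin n)} {u : Equiv.Perm (Fin r)} (hwu : ∀ a, w (ι a) = ι (u a))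
    (T : Finset ℕ) : fixedChains T (Set.range ι) w = fixedChains T Set.univ u := by
  rw [fixedChains, fixedChains, Nat.cast_inj,
    ← Set.ncard_image_of_injective _ (Set.image_injective.mpr
      (extendSetoid_injective (ι := ι) (hι := hι)))]
  congr 1
  have hsupp : ∀ D : Set (Setoid (Fin r)),
      chainSupport (extendSetoid ι hι '' D) = Set.range ι ↔ chainSupport D = Set.univ := by
    intro D
    rw [chainSupport_image_extendSetoid, ← Set.image_univ, hι.image_injective.eq_iff]
  have hfix : ∀ D : Set (Setoid (Fin r)), permute w '' (extendSetoid ι hι '' D) =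
      extendSetoid ι hι '' D ↔ permute u '' D = D := by
    intro D
    rw [← (Set.image_injective.mpr (extendSetoid_injective (ι := ι) (hι := hι))).eq_iff,
      Set.image_image, Set.image_image, Set.image_congr fun q _ => permute_extendSetoid hwu q]
  ext C
  constructor
  · rintro ⟨h1, h2, h3⟩
    obtain ⟨D, rfl⟩ := exists_image_extendSetoid_eq (hι := hι) h2.subset
    exact ⟨D, ⟨image_extendSetoid_mem_chainsOfRank.mp h1, (hsupp D).mp h2, (hfix D).mp h3⟩, rfl⟩
  · rintro ⟨D, ⟨h1, h2, h3⟩, rfl⟩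
    exact ⟨image_extendSetoid_mem_chainsOfRank.mpr h1, (hsupp D).mpr h2, (hfix D).mpr h3⟩

theorem fixedChains_eq_zero (T : Finset ℕ) {A : Set (Fin n)} {w : Equiv.Perm (Fin n)}
    (h : w '' A ≠ A) : fixedChains T A w = 0 := by
  rw [fixedChains, Nat.cast_eq_zero, Set.ncard_eq_zero]
  refine Set.eq_empty_iff_forall_notMem.mpr ?_
  rintro C ⟨-, h2, h3⟩
  apply h
  rw [← h2, ← chainSupport_image_permute, h3]

open scoped Classical in
theorem alphaChar_eq_sum_fixedChains {T : Finset ℕ} {R : ℕ} (hT : ∀ t ∈ T, t ≤ R) (hR : R < n)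
    (w : Equiv.Perm (Fin n)) :
    alphaChar T (permute w) = ∑ r ∈ range (2 * R + 1), ∑ A ∈ powersetCard r (univ : Finset (Fin n)),
      fixedChains T (A : Set (Fin n)) w := by
  set F : Set (Set (Setoid (Fin n))) :=
    {C | C ∈ chainsOfRank (Fin n) T ∧ permute w '' C = C} with hF
  have := Fintype.ofFinite (Setoid (Fin n))
  have h1 : alphaChar T (permute w) = (F.toFinset.card : ℤ) := by
    rw [alphaChar, maxChains_eq_chainsOfRank fun t ht => by
      rw [Nat.card_fin]
      exact lt_of_le_of_lt (hT t ht) hR, ← Set.ncard_eq_toFinset_card']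
  have h2 : ∀ A : Finset (Fin n), fixedChains T (A : Set (Fin n)) w =
      ((F.toFinset.filter fun C => (chainSupport C).toFinset = A).card : ℤ) := by
    intro A
    rw [fixedChains, Nat.cast_inj, Set.ncard_eq_toFinset_card']
    congr 1
    ext C
    rw [Set.mem_toFinset, Finset.mem_filter, Set.mem_toFinset, ← Finset.coe_inj, Set.coe_toFinset]
    constructor
    · rintro ⟨h1, h2, h3⟩
      exact ⟨⟨h1, h3⟩, h2⟩
    · rintro ⟨⟨h1, h3⟩, h2⟩
      exact ⟨h1, h2, h3⟩
  rw [h1, Finset.card_eq_sum_card_fiberwise (f := fun C => (chainSupport C).toFinset)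
    (t := (range (2 * R + 1)).biUnion fun r => powersetCard r univ), Finset.sum_biUnion,
    Nat.cast_sum]
  · refine Finset.sum_congr rfl fun r _ => ?_
    rw [Nat.cast_sum]
    exact Finset.sum_congr rfl fun A _ => (h2 A).symm
  · intro r _ r' _ hr
    exact (Finset.pairwise_disjoint_powersetCard univ) hr
  · intro C hC
    rw [Finset.mem_coe, Set.mem_toFinset] at hC
    rw [Finset.mem_coe, Finset.mem_biUnion]
    refine ⟨_, ?_, Finset.mem_powersetCard.mpr ⟨subset_univ _, rfl⟩⟩
    rw [Finset.mem_range, ← Set.ncard_eq_toFinset_card']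
    have := ncard_chainSupport_le hC.1.2.1 fun p hp => hT _ (hC.1.1 p hp)
    omega

end Permute

section Coloring

variable {n r : ℕ}

theorem exists_perm_comp_eq {ι : Fin r → Fin n} (hι : Function.Injective ι)
    {w : Equiv.Perm (Fin n)} (hw : w '' Set.range ι = Set.range ι) :
    ∃ u : Equiv.Perm (Fin r), ∀ a, w (ι a) = ι (u a) := by
  have h1 : ∀ a, ∃ b, ι b = w (ι a) := by
    intro a
    have : w (ι a) ∈ w '' Set.range ι := ⟨_, ⟨a, rfl⟩, rfl⟩
    rwa [hw] at this
  choose u hu using h1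
  have hinj : Function.Injective u := by
    intro a b hab
    apply hι
    apply w.injective
    rw [← hu, ← hu, hab]
  exact ⟨Equiv.ofBijective u (Finite.injective_iff_bijective.mp hinj), fun a => (hu a).symm⟩

/-- The number of colorings fixed by `w` with given content, such that the points with
nonzero color form the set `A`. -/
def fixedColorings {q : ℕ} (α : Fin q → ℤ) (A : Finset (Fin n)) (w : Equiv.Perm (Fin n)) : ℤ :=
  ((univ.filter fun f : Fin n → Fin (q + 1) => (∀ x, f (w x) = f x) ∧
    (∀ j : Fin q, ((univ.filter fun x => f x = j.succ).card : ℤ) = α j) ∧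
    univ.filter (fun x => f x ≠ 0) = A).card : ℤ)

theorem fixedColorings_range {q : ℕ} (α : Fin q → ℤ) {A : Finset (Fin n)} {ι : Fin r → Fin n}
    (hι : Function.Injective ι) (hA : (A : Set (Fin n)) = Set.range ι)
    {w : Equiv.Perm (Fin n)} {u : Equiv.Perm (Fin r)} (hwu : ∀ a, w (ι a) = ι (u a)) :
    fixedColorings α A w = youngChar α u := by
  have hmemA : ∀ x, x ∈ A ↔ ∃ a, ι a = x := fun x => by
    rw [← Finset.mem_coe, hA, Set.mem_range]
  set E : (Fin r → Fin q) → Fin n → Fin (q + 1) :=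
    fun g => Function.extend ι (fun a => (g a).succ) fun _ => 0 with hE
  have hE1 : ∀ g a, E g (ι a) = (g a).succ := fun g a => hι.extend_apply _ _ a
  have hE2 : ∀ g x, x ∉ A → E g x = 0 := fun g x hx =>
    Function.extend_apply' _ _ _ fun h => hx ((hmemA x).mpr h)
  have hcard : ∀ g (j : Fin q), (univ.filter fun x => E g x = j.succ).card =
      (univ.filter fun a => g a = j).card := by
    intro g j
    rw [← Finset.card_image_of_injective _ hι]
    congr 1
    ext x
    simp only [Finset.mem_filter, mem_univ, true_and, Finset.mem_image]
    constructor
    · intro h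
      have hx : x ∈ A := by
        by_contra hx
        rw [hE2 g x hx] at h
        exact Fin.succ_ne_zero j h.symm
      obtain ⟨a, rfl⟩ := (hmemA x).mp hx
      rw [hE1] at h
      exact ⟨a, Fin.succ_injective _ h, rfl⟩
    · rintro ⟨a, h, rfl⟩
      rw [hE1, h]
  have hsupp : ∀ g, univ.filter (fun x => E g x ≠ 0) = A := by
    intro g
    ext x
    simp only [Finset.mem_filter, mem_univ, true_and]
    constructor
    · intro h
      by_contra hx
      exact h (hE2 g x hx)
    · intro h
      obtain ⟨a, rfl⟩ := (hmemA x).mp h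
      rw [hE1]
      exact Fin.succ_ne_zero _
  have hwA : ∀ x, w x ∈ A ↔ x ∈ A := by
    intro x
    have h1 : ∀ a, w (ι a) ∈ A := fun a => (hmemA _).mpr ⟨u a, (hwu a).symm⟩
    constructor
    · intro h
      obtain ⟨a, ha⟩ := (hmemA _).mp h
      have : w (ι (u⁻¹ a)) = w x := by
        rw [hwu, ← ha]
        simp
      rw [← w.injective this]
      exact (hmemA _).mpr ⟨_, rfl⟩
    · intro h
      obtain ⟨a, rfl⟩ := (hmemA _).mp h
      exact h1 a
  have hfix : ∀ g, (∀ x, E g (w x) = E g x) ↔ ∀ a, g (u a) = g a := by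
    intro g
    constructor
    · intro h a
      have := h (ι a)
      rw [hwu, hE1, hE1] at this
      exact Fin.succ_injective _ this
    · intro h x
      by_cases hx : x ∈ A
      · obtain ⟨a, rfl⟩ := (hmemA x).mp hx
        rw [hwu, hE1, hE1, h]
      · rw [hE2 g x hx, hE2 g _ (mt (hwA x).mp hx)]
  have hEinj : Function.Injective E := by
    intro g g' h
    funext a
    have := congrFun h (ι a)
    rw [hE1, hE1] at this
    exact Fin.succ_injective _ this
  rw [fixedColorings, youngChar, Nat.cast_inj, ← Finset.card_image_of_injective _ hEinj]
  congr 1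
  ext f
  simp only [Finset.mem_filter, mem_univ, true_and, Finset.mem_image]
  constructor
  · rintro ⟨h1, h2, h3⟩
    have h4 : ∀ a, f (ι a) ≠ 0 := by
      intro a
      have : ι a ∈ A := (hmemA _).mpr ⟨a, rfl⟩
      rw [← h3] at this
      exact (Finset.mem_filter.mp this).2
    have h5 : E (fun a => (f (ι a)).pred (h4 a)) = f := by
      funext x
      by_cases hx : x ∈ A
      · obtain ⟨a, rfl⟩ := (hmemA x).mp hx
        rw [hE1, Fin.succ_pred]
      · rw [hE2 _ x hx]
        by_contra hne
        apply hx
        rw [← h3]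
        exact Finset.mem_filter.mpr ⟨mem_univ _, Ne.symm hne⟩
    refine ⟨_, ⟨?_, ?_⟩, h5⟩
    · exact (hfix _).mp (by rw [h5]; exact h1)
    · intro j
      rw [← hcard, h5]
      exact h2 j
  · rintro ⟨g, ⟨h1, h2⟩, rfl⟩
    refine ⟨(hfix g).mpr h1, fun j => ?_, hsupp g⟩
    rw [hcard]
    exact h2 j

theorem fixedColorings_eq_zero {q : ℕ} (α : Fin q → ℤ) {A : Finset (Fin n)}
    {w : Equiv.Perm (Fin n)} (h : w '' (A : Set (Fin n)) ≠ A) : fixedColorings α A w = 0 := by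
  rw [fixedColorings, Nat.cast_eq_zero, Finset.card_eq_zero]
  refine Finset.eq_empty_iff_forall_notMem.mpr fun f hf => ?_
  obtain ⟨h1, -, h3⟩ := (Finset.mem_filter.mp hf).2
  have h4 : ∀ x, x ∈ A ↔ f x ≠ 0 := fun x => by
    rw [← h3, Finset.mem_filter]
    exact and_iff_right (mem_univ x)
  apply h
  ext x
  rw [Finset.mem_coe, h4]
  constructor
  · rintro ⟨y, hy, rfl⟩
    rw [h1]
    exact (h4 y).mp hy
  · intro hx
    refine ⟨w⁻¹ x, ?_, by simp⟩
    rw [Finset.mem_coe, h4, ← h1]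
    simpa using hx

theorem youngChar_cons_eq_sum {q : ℕ} (α : Fin q → ℤ) (hα : ∑ j, α j = r)
    (w : Equiv.Perm (Fin n)) :
    youngChar (Fin.cons ((n : ℤ) - r) α : Fin (q + 1) → ℤ) w =
      ∑ A ∈ powersetCard r univ, fixedColorings α A w := by
  have hsum : ∀ f : Fin n → Fin (q + 1),
      (n : ℤ) = (univ.filter fun x => f x = 0).card +
        ∑ j : Fin q, ((univ.filter fun x => f x = j.succ).card : ℤ) := by
    intro f
    rw [← Nat.cast_sum, ← Nat.cast_add, Nat.cast_inj,
      ← Fin.sum_univ_succ fun j => (univ.filter fun x => f x = j).card,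
      ← Finset.card_eq_sum_card_fiberwise (fun _ _ => mem_coe.mpr (mem_univ _))]
    simp
  have hcompl : ∀ f : Fin n → Fin (q + 1),
      (univ.filter fun x => f x = 0).card + (univ.filter fun x => f x ≠ 0).card = n := by
    intro f
    have := Finset.card_filter_add_card_filter_not (s := (univ : Finset (Fin n))) fun x => f x = 0
    simpa using this
  simp only [fixedColorings]
  rw [youngChar, ← Nat.cast_sum, Nat.cast_inj,
    Finset.card_eq_sum_card_fiberwise (f := fun f => univ.filter fun x => f x ≠ 0)
      (t := powersetCard r univ)]
  · refine Finset.sum_congr rfl fun A hA => ?_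
    rw [Finset.mem_powersetCard] at hA
    congr 1
    ext f
    simp only [Finset.mem_filter, mem_univ, true_and, Fin.forall_fin_succ (n := q), Fin.cons_zero,
      Fin.cons_succ]
    constructor
    · rintro ⟨⟨h1, -, h2⟩, h3⟩
      exact ⟨h1, h2, h3⟩
    · rintro ⟨h1, h2, h3⟩
      refine ⟨⟨h1, ?_, h2⟩, h3⟩
      have := hsum f
      rw [Finset.sum_congr rfl fun j _ => h2 j, hα] at this
      linarith
  · intro f hf
    rw [Finset.mem_coe, Finset.mem_filter, Fin.forall_fin_succ, Fin.cons_zero] at hf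
    rw [Finset.mem_coe, Finset.mem_powersetCard]
    refine ⟨subset_univ _, ?_⟩
    have h1 := hcompl f
    have h2 := hf.2.2.1
    change (univ.filter fun x => f x ≠ 0).card = r
    omega

/-- If the class function `f` on `S_r` is `∑_p a_p s_p`, then `h_{n-r} ∑_p a_p s_p` is the sum over
the `r`-element subsets stable under `w` of the value of `f` at the restriction of `w`. -/
theorem sum_fixedChains_eq {T : Finset ℕ} {a : r.Partition → ℤ}
    (ha : ∀ u : Equiv.Perm (Fin r), fixedChains T Set.univ u = ∑ p, a p * irrChar (rows p) u)
    (w : Equiv.Perm (Fin n)) :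
    ∑ A ∈ powersetCard r (univ : Finset (Fin n)), fixedChains T (A : Set (Fin n)) w =
      ∑ p, a p * inducedSchurChar ((n : ℤ) - r) (fun i => ((rows p).get i : ℤ)) w := by
  have h1 : ∀ p : r.Partition,
      inducedSchurChar ((n : ℤ) - r) (fun i => ((rows p).get i : ℤ)) w =
      ∑ A ∈ powersetCard r univ, ∑ σ : Equiv.Perm (Fin (rows p).length),
        (Equiv.Perm.sign σ : ℤ) *
          fixedColorings (fun i => ((rows p).get i : ℤ) - (i : ℕ) + (σ i : ℕ)) A w := by
    intro p
    rw [inducedSchurChar, Finset.sum_comm]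
    refine Finset.sum_congr rfl fun σ _ => ?_
    rw [youngChar_cons_eq_sum _ ((sum_sub_val_add_perm _ σ).trans
      ((sum_get_cast (rows p)).trans (by rw [rows_sum]))), Finset.mul_sum]
  simp only [h1, Finset.mul_sum (powersetCard r univ)]
  rw [Finset.sum_comm]
  refine Finset.sum_congr rfl fun A hA => ?_
  rw [Finset.mem_powersetCard] at hA
  by_cases hw : w '' (A : Set (Fin n)) = A
  · have hι : Function.Injective (A.orderEmbOfFin hA.2) := (A.orderEmbOfFin hA.2).injective
    have hAr : (A : Set (Fin n)) = Set.range (A.orderEmbOfFin hA.2) :=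
      (Finset.range_orderEmbOfFin A hA.2).symm
    obtain ⟨u, hu⟩ := exists_perm_comp_eq hι (w := w) (by rw [← hAr]; exact hw)
    rw [hAr, fixedChains_range hι hu, ha]
    refine Finset.sum_congr rfl fun p _ => ?_
    rw [irrChar]
    congr 1
    refine Finset.sum_congr rfl fun σ _ => ?_
    rw [fixedColorings_range _ hι hAr hu]
  · rw [fixedChains_eq_zero T hw]
    symm
    refine Finset.sum_eq_zero fun p _ => ?_
    rw [Finset.sum_eq_zero, mul_zero]
    intro σ _
    rw [fixedColorings_eq_zero _ hw, mul_zero]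

end Coloring

section Burnside

/-- Orbit counting for a stable subset of a finite set with a group action. -/
theorem card_dvd_sum_ncard_fixed {G X : Type*} [Group G] [Fintype G] [Finite X]
    (φ : G →* Equiv.Perm X) (E : Set X) (hE : ∀ g, ∀ x ∈ E, φ g x ∈ E) :
    Fintype.card G ∣ ∑ g, {x | x ∈ E ∧ φ g x = x}.ncard := by
  classical
  have := Fintype.ofFinite X
  let act : MulAction G E :=
    { smul := fun g x => ⟨φ g x, hE g x x.2⟩
      one_smul := fun x => Subtype.ext (by
        change φ 1 (x : X) = x
        rw [map_one, Equiv.Perm.one_apply])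
      mul_smul := fun g h x => Subtype.ext (by
        change φ (g * h) (x : X) = φ g (φ h x)
        rw [map_mul, Equiv.Perm.mul_apply]) }
  have := Fintype.ofFinite (Quotient (MulAction.orbitRel G E))
  refine ⟨_, (Eq.trans ?_ (MulAction.sum_card_fixedBy_eq_card_orbits_mul_card_group G E)).trans
    (mul_comm _ _)⟩
  refine Finset.sum_congr rfl fun g _ => ?_
  rw [← Nat.card_eq_fintype_card, ← Nat.card_coe_set_eq]
  refine Nat.card_congr
    { toFun := fun x => ⟨⟨x, x.2.1⟩, Subtype.ext x.2.2⟩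
      invFun := fun x => ⟨x.1, x.1.2, congrArg Subtype.val x.2⟩
      left_inv := fun _ => rfl
      right_inv := fun _ => rfl }

variable {n : ℕ}

theorem isClassFunction_fixedChains (T : Finset ℕ) :
    IsClassFunction (n := n) (fixedChains T Set.univ) := by
  intro u v
  rw [fixedChains, fixedChains, Nat.cast_inj]
  have hinj : Function.Injective fun C : Set (Setoid (Fin n)) => permute u '' C :=
    Set.image_injective.mpr (permute u).injective
  rw [← Set.ncard_image_of_injective {C | C ∈ chainsOfRank (Fin n) T ∧ chainSupport C = Set.univ ∧
    permute v '' C = C} hinj]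
  congr 1
  have hiff : ∀ D : Set (Setoid (Fin n)),
      (permute u '' D ∈ chainsOfRank (Fin n) T ∧ chainSupport (permute u '' D) = Set.univ ∧
        permute (u * v * u⁻¹) '' (permute u '' D) = permute u '' D) ↔
      (D ∈ chainsOfRank (Fin n) T ∧ chainSupport D = Set.univ ∧ permute v '' D = D) := by
    intro D
    rw [image_permute_mem_chainsOfRank, chainSupport_image_permute, ← image_permute_mul,
      inv_mul_cancel_right, image_permute_mul, hinj.eq_iff]
    have : u '' chainSupport D = Set.univ ↔ chainSupport D = Set.univ := by
      rw [← Set.image_univ_of_surjective u.surjective, u.injective.image_injective.eq_iff,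
        Set.image_univ_of_surjective u.surjective]
    rw [this]
  ext C
  constructor
  · intro hC
    have hD : permute u '' (permute u⁻¹ '' C) = C := by
      rw [← image_permute_mul, mul_inv_cancel, image_permute_one]
    refine ⟨permute u⁻¹ '' C, (hiff _).mp ?_, hD⟩
    rw [hD]
    exact hC
  · rintro ⟨D, hD, rfl⟩
    exact (hiff D).mpr hD

/-- The action of the symmetric group on pairs of a family of set partitions and a coloring. -/
def chainColoringHom (n l : ℕ) :
    Equiv.Perm (Fin n) →* Equiv.Perm (Set (Setoid (Fin n)) × (Fin n → Fin l)) :=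
  MonoidHom.mk'
    (fun u => Equiv.prodCongr (Equiv.Set.congr (permute u).toEquiv)
      (Equiv.arrowCongr u (Equiv.refl _)))
    (fun u v => by
      refine Equiv.ext fun x => Prod.ext ?_ rfl
      exact image_permute_mul u v x.1)

theorem factorial_dvd_pairing_fixedChains (T : Finset ℕ) {l : ℕ} (α : Fin l → ℤ) :
    (n.factorial : ℤ) ∣ pairing (n := n) (fixedChains T Set.univ) (youngChar α) := by
  set E : Set (Set (Setoid (Fin n)) × (Fin n → Fin l)) :=
    {x | (x.1 ∈ chainsOfRank (Fin n) T ∧ chainSupport x.1 = Set.univ) ∧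
      ∀ j, ((univ.filter fun y => x.2 y = j).card : ℤ) = α j} with hE
  have hval : ∀ (u : Equiv.Perm (Fin n)) (x : Set (Setoid (Fin n)) × (Fin n → Fin l)),
      chainColoringHom n l u x = (permute u '' x.1, fun y => x.2 (u⁻¹ y)) := fun u x => rfl
  have hEφ : ∀ u, ∀ x ∈ E, chainColoringHom n l u x ∈ E := by
    rintro u ⟨C, f⟩ ⟨⟨h1, h2⟩, h3⟩
    rw [hval]
    refine ⟨⟨(image_permute_mem_chainsOfRank u).mpr h1, ?_⟩, fun j => ?_⟩
    · simp only at h2 ⊢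
      rw [chainSupport_image_permute, h2, Set.image_univ_of_surjective u.surjective]
    · rw [← h3 j, Nat.cast_inj]
      exact Finset.card_equiv u⁻¹ fun x => by simp
  have h := card_dvd_sum_ncard_fixed (chainColoringHom n l) E hEφ
  rw [Fintype.card_perm, Fintype.card_fin] at h
  have h' : pairing (n := n) (fixedChains T Set.univ) (youngChar α) =
      ((∑ u, {x | x ∈ E ∧ chainColoringHom n l u x = x}.ncard : ℕ) : ℤ) := by
    rw [pairing, Nat.cast_sum]
    refine Finset.sum_congr rfl fun u _ => ?_
    rw [fixedChains, youngChar, ← Nat.cast_mul, Nat.cast_inj, ← Set.ncard_coe_finset,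
      ← Set.ncard_prod]
    congr 1
    ext ⟨C, f⟩
    have hf : (fun y => f (u⁻¹ y)) = f ↔ ∀ x, f (u x) = f x := by
      constructor
      · intro h x
        simpa using (congrFun h (u x)).symm
      · intro h
        funext y
        simpa using (h (u⁻¹ y)).symm
    rw [Set.mem_prod, Finset.mem_coe, Finset.mem_filter]
    constructor
    · rintro ⟨⟨h1, h2, h3⟩, -, h4, h5⟩
      exact ⟨⟨⟨h1, h2⟩, h5⟩, Prod.ext h3 (hf.mpr h4)⟩
    · rintro ⟨⟨⟨h1, h2⟩, h5⟩, h6⟩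
      exact ⟨⟨h1, h2, congrArg Prod.fst h6⟩, mem_univ _, hf.mp (congrArg Prod.snd h6), h5⟩
  rw [h']
  exact_mod_cast h

theorem exists_fixedChains_eq_sum (T : Finset ℕ) (r : ℕ) :
    ∃ a : r.Partition → ℤ, ∀ u : Equiv.Perm (Fin r),
      fixedChains T Set.univ u = ∑ p, a p * irrChar (rows p) u :=
  (isClassFunction_fixedChains T).exists_eq_sum fun _ α => factorial_dvd_pairing_fixedChains T α

end Burnside

section Partitions

/-- The part of `β_S(Π_r)` spanned by the chains whose support is everything. -/
noncomputable def betaFull (S : Finset ℕ) (r : ℕ) (u : Equiv.Perm (Fin r)) : ℤ :=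
  ∑ T ∈ S.powerset, (-1) ^ (S \ T).card * fixedChains T Set.univ u

theorem exists_betaPartition_eq_sum {S : Finset ℕ} {i : ℕ} (hS : ∀ s ∈ S, s ≤ i) :
    ∃ a : ∀ r : ℕ, r.Partition → ℤ,
      (∀ r u, betaFull S r u = ∑ p, a r p * irrChar (rows p) u) ∧
      ∀ n, i < n → ∀ w : Equiv.Perm (Fin n), betaPartition S n w =
        ∑ r ∈ range (2 * i + 1), ∑ p : r.Partition,
          a r p * inducedSchurChar ((n : ℤ) - r) (fun j => ((rows p).get j : ℤ)) w := by
  choose a ha using exists_fixedChains_eq_sum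
  have hlin : ∀ (r : ℕ) (F : r.Partition → ℤ),
      ∑ p, (∑ T ∈ S.powerset, (-1) ^ (S \ T).card * a T r p) * F p =
      ∑ T ∈ S.powerset, (-1) ^ (S \ T).card * ∑ p, a T r p * F p := by
    intro r F
    simp only [Finset.sum_mul, Finset.mul_sum]
    rw [Finset.sum_comm]
    exact Finset.sum_congr rfl fun _ _ => Finset.sum_congr rfl fun _ _ => by ring
  refine ⟨fun r p => ∑ T ∈ S.powerset, (-1) ^ (S \ T).card * a T r p, ?_, ?_⟩
  · intro r u
    rw [hlin, betaFull]
    exact Finset.sum_congr rfl fun T _ => by rw [ha]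
  · intro n hn w
    simp only [hlin]
    rw [Finset.sum_comm, betaPartition, betaChar]
    refine Finset.sum_congr rfl fun T hT => ?_
    rw [← Finset.mul_sum, alphaChar_eq_sum_fixedChains
      (fun t ht => hS t (Finset.mem_powerset.mp hT ht)) hn]
    congr 1
    exact Finset.sum_congr rfl fun r _ => sum_fixedChains_eq (ha T r) w

/-- The set partition of `2 i` points into pairs of neighbors. -/
def pairPartition (i : ℕ) : Setoid (Fin (2 * i)) :=
  Setoid.ker fun x => (⟨(x : ℕ) / 2, by omega⟩ : Fin i)

theorem setoidRank_pairPartition (i : ℕ) : setoidRank (pairPartition i) = i := by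
  have hsurj : Function.Surjective fun x : Fin (2 * i) => (⟨(x : ℕ) / 2, by omega⟩ : Fin i) := by
    intro y
    refine ⟨⟨2 * y, by omega⟩, Fin.ext ?_⟩
    simp
  have h1 := Nat.card_congr (Setoid.quotientKerEquivOfSurjective _ hsurj)
  rw [Nat.card_fin] at h1
  rw [setoidRank, pairPartition, h1, Nat.card_fin]
  omega

theorem support_pairPartition (i : ℕ) : support (pairPartition i) = Set.univ := by
  refine Set.eq_univ_of_forall fun x => ?_
  refine ⟨⟨2 * ((x : ℕ) / 2) + (1 - (x : ℕ) % 2), by omega⟩, fun h => ?_, ?_⟩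
  · have := congrArg Fin.val h
    simp only at this
    omega
  · rw [pairPartition, Setoid.ker_def, Fin.mk.injEq]
    change (x : ℕ) / 2 = (2 * ((x : ℕ) / 2) + (1 - (x : ℕ) % 2)) / 2
    omega

theorem sum_betaFull_singleton_pos {i : ℕ} (hi : 0 < i) :
    0 < ∑ u, betaFull {i} (2 * i) u := by
  have hempty : ∀ u : Equiv.Perm (Fin (2 * i)), fixedChains ∅ Set.univ u = 0 := by
    intro u
    rw [fixedChains, Nat.cast_eq_zero, Set.ncard_eq_zero]
    refine Set.eq_empty_iff_forall_notMem.mpr ?_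
    rintro C ⟨⟨h1, -⟩, h2, -⟩
    have hC : C = ∅ := Set.eq_empty_of_forall_notMem fun p hp => by simpa using h1 p hp
    have : (⟨0, by omega⟩ : Fin (2 * i)) ∈ chainSupport C := by
      rw [h2]
      trivial
    rw [hC] at this
    simp [chainSupport] at this
  have hval : ∀ u : Equiv.Perm (Fin (2 * i)),
      betaFull {i} (2 * i) u = fixedChains {i} Set.univ u := by
    intro u
    have hne : (∅ : Finset ℕ) ≠ {i} := (Finset.singleton_ne_empty i).symm
    rw [betaFull, show ({i} : Finset ℕ).powerset = {∅, {i}} from rfl, Finset.sum_pair hne, hempty]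
    simp
  rw [Finset.sum_congr rfl fun u _ => hval u]
  refine Finset.sum_pos' (fun u _ => ?_) ⟨1, mem_univ _, ?_⟩
  · rw [fixedChains]
    positivity
  · rw [fixedChains, Nat.cast_pos, Set.ncard_pos]
    refine ⟨{pairPartition i}, ⟨?_, ?_, ?_⟩, ?_, image_permute_one _⟩
    · rintro p rfl
      rw [setoidRank_pairPartition]
      simp
    · exact Set.subsingleton_singleton.isChain
    · intro t ht
      rw [Finset.mem_singleton] at ht
      exact ⟨_, rfl, (setoidRank_pairPartition i).trans ht.symm⟩
    · rw [chainSupport, Set.biUnion_singleton, support_pairPartition]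

end Partitions

end RankSelection

theorem theorem1p6 (S : Finset ℕ) (hpos : ∀ s ∈ S, 0 < s) (i : ℕ)
    (hmax : IsGreatest (S : Set ℕ) i) :
    RankSelection.StabilizesBeyond (RankSelection.betaPartition S) (4 * i) ∧
      (S = {i} →
        RankSelection.StabilizesSharplyAt (RankSelection.betaPartition S) (4 * i)) := by
  have hi : 0 < i := hpos i hmax.1
  obtain ⟨a, hfull, ha⟩ :=
    RankSelection.exists_betaPartition_eq_sum (S := S) (i := i) fun s hs => hmax.2 hs
  have hstab : RankSelection.StabilizesBeyond (RankSelection.betaPartition S) (4 * i) :=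
    RankSelection.stabilizesBeyond_of_eq_sum _ (R := 2 * i) (by omega) (by omega) a
      fun n hn => ha n (by omega)
  refine ⟨hstab, fun hS => ⟨hstab, fun k hk => ?_⟩⟩
  by_contra hlt
  have h4 : 4 * i = 2 * (2 * i) := by ring
  have h0 := RankSelection.StabilizesBeyond.pairing_two_rows_eq_zero (c := 2 * i) hk (by omega)
  rw [RankSelection.pairing_eq_inducedMult (ha (2 * (2 * i)) (by omega))] at h0
  have hmult : RankSelection.inducedMult (2 * i) a (2 * (2 * i)) [2 * i, 2 * i] = 0 := by
    refine (mul_eq_zero.mp h0).resolve_left ?_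
    positivity
  have h1 := RankSelection.factorial_mul_inducedMult_two_rows a (2 * i) _ (hfull (2 * i))
  rw [hmult, mul_zero, hS] at h1
  have h2 := RankSelection.sum_betaFull_singleton_pos hi
  omega
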